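/- **Setting.** Let $u:\mathbb{R}\times\mathbb{R}^2\to\mathbb{R}^2$ be a smooth velocity field, all of whose derivatives are bounded, which is divergence free in space and satisfies $|u|\le U$ for some $U>0$. Let $\Psi^{s\to t}$ be its flow map from time $s$ to time $t$, and write $M_0(A)$ for the area of $A\subset\mathbb{R}^2$. *Mesh.* A domain $\Omega\subset\mathbb{R}^2$ is the union of finitely many control volumes $c\in\mathcal{C}$, which are closed simple polygons with pairwise disjoint interiors; $h$ is the maximum of their diameters. The meshes are regular with constants $N$ and $\kappa,\sigma>0$: each $c$ has at most $N$ corners, $M_0(c)\ge\kappa h^2$, and two control volumes without a common vertex are at distance at least $\sigma h$. Let $\mathcal{C}(c)$ be the set of control volumes that share a vertex with $c$ (including $c$). *Exact step.* Consider one time step from $t$ to $t+\delta$ with $\delta>0$ and $\delta\le\sigma h/U$ (CFL). Let $\Omega^l\subset\Omega$ be the (measurable) liquid domain at time $t$, so that $\Psi^{t\to t+\delta}\Omega^l$ is the liquid domain at time $t+\delta$, and let $$\alpha_c=\frac{M_0(c\cap\Psi^{t\to t+\delta}\Omega^l)}{M_0(c)},\qquad P_c=(\Psi^{t\to t+\delta})^{-1}(c).$$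 *Approximate step.* For a polygon given by its cyclic list of corners, take as its region the curve together with the points around which it has nonzero winding number. Let $P_c^{\rm Rep}$ be the polygon whose corners are the images of the corners of $c$ under $\Psi^{t+\delta\to t}$. Let $\tilde P_c$ be the polygon whose corners are obtained from those of $c$ by one backward step of length $\delta$, from $t+\delta$ to $t$, of a Runge–Kutta method of order $q$, applied to the interpolated velocity field $u^{\rm Int}$. Order $q$ means that for smooth velocity fields with bounded derivatives the error of one step of length $\delta$ is $O(|\delta|^{q+1})$. The field $u^{\rm Int}$ is obtained from the values of $u$ at staggered nodes (each velocity component has its own nodes) at the times $t$ and $t+\delta$, by linear interpolation in time and by a rule in space which is exact for affine functions, uses finitely many nodes at distance at most $\rho h$, and has weights whose absolute values sum to at most $\Lambda$. For each $c$ let the set $\tilde\Omega^l_c$ (measurable, of finite area) be an approximation of $\Omega^l_c=\Omega^l\cap\bigcup_{c'\in\mathcal{C}(c)}c'$, and let $$\tilde\alpha_c=\frac{M_0(\tilde P_c\cap\tilde\Omega^l_c)}{M_0(c)}.$$ *Errors.* Let $E_0^{\rm Rec}=M_0(\tilde\Omega^l_c\,\triangle\,\Omega^l_c)$, $E_0^{\rm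 Rep}=M_0(P_c^{\rm Rep}\,\triangle\,P_c)$ and $E_0^{\rm Int}=M_0(\tilde P_c\,\triangle\,P_c^{\rm Rep})$, where $\triangle$ is the symmetric difference. **Theorem.** Suppose that the local order of accuracy of the liquid domain approximation is $r\in\mathbb{R}$, that is, $E_0^{\rm Rec}\le K h^r$ for all $c$. Then $$\|\tilde\alpha-\alpha\|_{L^\infty}=\max_{c\in\mathcal{C}}|\tilde\alpha_c-\alpha_c|\le C_1h^{r-2}+C_2h^2+C_3(h^2+h^q)$$ for all $h\le h_0$. The constants $C_1,C_2,C_3$ and $h_0>0$ depend only on $\Omega$, $u$, $U$, the Runge–Kutta method, $q,r,K,N,\kappa,\sigma,\rho,\Lambda$, and not on the mesh, $t$, $\delta$, the interpolation rule, the liquid domain or its approximation. The three terms come from the reconstruction, the polygonal representation and the integration: for each $c$, $$|\tilde\alpha_c-\alpha_c|\le\frac{E_0^{\rm Rec}+E_0^{\rm Rep}+E_0^{\rm Int}}{M_0(c)},\quad \frac{E_0^{\rm Rec}}{M_0(c)}\le C_1h^{r-2},\quad \frac{E_0^{\rm Rep}}{M_0(c)}\le C_2h^2,\quad \frac{E_0^{\rm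 Int}}{M_0(c)}\le C_3(h^2+h^q).$$ -/

import Mathlib

open MeasureTheory
open scoped ContDiff

noncomputable section

/-- The Euclidean plane. -/
abbrev Plane := EuclideanSpace ℝ (Fin 2)

/-- The zeroth moment (area) of a set. -/
def M0 (A : Set Plane) : ℝ := (volume : Measure Plane).real A

/-! ### Polygons -/

/-- The closed polygonal curve through `v 0, v 1, …, v (n - 1), v 0`, parametrised `n`-periodically:
on `[k, k + 1]` it runs along the straight segment from `v k` to `v (k + 1)`. -/
def polygonLoop {n : ℕ} (v : ZMod n → Plane) (s : ℝ) : Plane :=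
  AffineMap.lineMap (v ((⌊s⌋ : ℤ) : ZMod n)) (v (((⌊s⌋ : ℤ) : ZMod n) + 1)) (Int.fract s)

/-- The closed curve through the corners `v` avoids `x` and, as a loop `ℝ / nℤ → ℝ² \ {x}`, is
null-homotopic; equivalently, it avoids `x` and has winding number zero around `x`. -/
def PolygonContractibleOff {n : ℕ} (v : ZMod n → Plane) (x : Plane) : Prop :=
  ∃ g : C(AddCircle (n : ℝ), ({x}ᶜ : Set Plane)),
    (∀ s : ℝ, ((g (s : AddCircle (n : ℝ)) : ({x}ᶜ : Set Plane)) : Plane) = polygonLoop v s) ∧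
      g.Nullhomotopic

/-- The closed polygonal region with corners `v`: the points on the polygonal curve together with
the points around which it winds. For a simple polygon this is the curve with its Jordan interior. -/
def polygonRegion {n : ℕ} (v : ZMod n → Plane) : Set Plane :=
  {x | ¬ PolygonContractibleOff v x}

/-! ### Meshes -/

/-- A mesh of the domain `Ω` by finitely many control volumes, which are closed simple polygons
(not necessarily convex) with pairwise disjoint interiors. -/
structure PolygonalMesh (Ω : Set Plane) where
  numCells : ℕ
  numCorners : Fin numCells → ℕ
  corner : (c : Fin numCells) → ZMod (numCorners c) → Plane
  three_le : ∀ c, 3 ≤ numCorners c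
  simple : ∀ c, Set.InjOn (polygonLoop (corner c)) (Set.Ico 0 (numCorners c : ℝ))
  disjoint : ∀ c c', c ≠ c' →
    Disjoint (interior (polygonRegion (corner c))) (interior (polygonRegion (corner c')))
  cover : ⋃ c, polygonRegion (corner c) = Ω

namespace PolygonalMesh

variable {Ω : Set Plane} (M : PolygonalMesh Ω)

/-- The control volume `c`. -/
def cell (c : Fin M.numCells) : Set Plane := polygonRegion (M.corner c)

/-- The mesh size `h`: the maximum diameter of all control volumes. -/
def size : ℝ := ⨆ c, Metric.diam (M.cell c)

/-- Two control volumes are neighbours if they share at least one vertex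
(each control volume is its own neighbour). -/
def Neighbours (c c' : Fin M.numCells) : Prop :=
  ∃ i j, M.corner c i = M.corner c' j

/-- The union of the control volumes that share a vertex with `c`. -/
def neighbourhood (c : Fin M.numCells) : Set Plane :=
  ⋃ c' ∈ {c' | M.Neighbours c c'}, M.cell c'

/-- Mesh regularity with constants `N`, `κ`, `σ`: at most `N` edges per control volume, areas
comparable to `h ^ 2`, and control volumes without a common vertex are at least `σ h` apart. -/
structure IsRegular (N : ℕ) (κ σ : ℝ) : Prop where
  corners_le : ∀ c, M.numCorners c ≤ N
  area_ge : ∀ c, κ * M.size ^ 2 ≤ M0 (M.cell c)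
  separated : ∀ c c', ¬ M.Neighbours c c' →
    ∀ x ∈ M.cell c, ∀ y ∈ M.cell c', σ * M.size ≤ dist x y

end PolygonalMesh

/-! ### Velocity field and flow map -/

/-- `u` is smooth in `(t, x)`, and each of its derivatives is bounded. -/
def SmoothBounded (u : ℝ → Plane → Plane) : Prop :=
  ContDiff ℝ ∞ (Function.uncurry u) ∧
    ∀ m : ℕ, ∃ B : ℝ, ∀ z, ‖iteratedFDeriv ℝ m (Function.uncurry u) z‖ ≤ B

/-- The velocity field is divergence free (in space, at every time). -/
def DivergenceFree (u : ℝ → Plane → Plane) : Prop :=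
  ∀ t x, ∑ i : Fin 2, (fderiv ℝ (u t) x (EuclideanSpace.single i 1)) i = 0

/-- `γ` is a pathline of the velocity field `u`. -/
def IsPathline (u : ℝ → Plane → Plane) (γ : ℝ → Plane) : Prop :=
  ∀ t, HasDerivAt γ (u t (γ t)) t

/-- `Ψ` is the flow map of `u`: `Ψ s t x` is the position at time `t` of the particle which is at
`x` at time `s`. -/
def IsFlowMap (u : ℝ → Plane → Plane) (Ψ : ℝ → ℝ → Plane → Plane) : Prop :=
  ∀ s x, Ψ s s x = x ∧ IsPathline u (fun t => Ψ s t x)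

/-! ### Linear interpolation of a staggered velocity field -/

/-- A linear interpolation rule in space from a staggered arrangement, on a mesh of size `h`. The
`k`-th velocity component is stored at the locations `node k`; its value at `x` is a weighted sum of
the values at the finitely many nodes in `stencil k x`. These lie within `ρ h` of `x`, the rule
reproduces affine functions, and the absolute values of the weights sum to at most `Λ`
(`Λ = 1` for nonnegative weights; larger `Λ` allows linear extrapolation near the boundary). -/
structure StaggeredInterpolation (ρ Λ h : ℝ) where
  node : Fin 2 → Set Plane
  stencil : Fin 2 → Plane → Finset Plane
  weight : Fin 2 → Plane → Plane → ℝ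
  stencil_node : ∀ k x, ∀ p ∈ stencil k x, p ∈ node k
  stencil_near : ∀ k x, ∀ p ∈ stencil k x, dist p x ≤ ρ * h
  sum_abs_weight : ∀ k x, ∑ p ∈ stencil k x, |weight k x p| ≤ Λ
  sum_weight : ∀ k x, ∑ p ∈ stencil k x, weight k x p = 1
  sum_weight_smul : ∀ k x, ∑ p ∈ stencil k x, weight k x p • p = x

/-- The velocity field interpolated linearly in space and in time, from the values of `u` at the
times `t` and `t + δ` at the staggered nodes. -/
def StaggeredInterpolation.field {ρ Λ h : ℝ} (I : StaggeredInterpolation ρ Λ h)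
    (u : ℝ → Plane → Plane) (t δ : ℝ) (τ : ℝ) (x : Plane) : Plane :=
  WithLp.toLp 2 fun k => ∑ p ∈ I.stencil k x, I.weight k x p *
    ((t + δ - τ) / δ * u t p k + (τ - t) / δ * u (t + δ) p k)

/-! ### Time integration -/

/-- The coefficients of a Runge–Kutta method (explicit or implicit) with `s` stages. -/
structure RungeKutta (s : ℕ) where
  A : Fin s → Fin s → ℝ
  b : Fin s → ℝ
  c : Fin s → ℝ

/-- `y` results from one step of (signed) length `δ` from `(t, x)`, for the velocity field `v`. -/
def RungeKutta.IsStep {s : ℕ} (R : RungeKutta s) (v : ℝ → Plane → Plane) (t δ : ℝ)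
    (x y : Plane) : Prop :=
  ∃ k : Fin s → Plane,
    (∀ i, k i = v (t + R.c i * δ) (x + δ • ∑ j, R.A i j • k j)) ∧ y = x + δ • ∑ i, R.b i • k i

/-- The method has order of accuracy `q`: for smooth velocity fields the error of one step is
`O(|δ| ^ (q + 1))`. -/
def RungeKutta.HasOrder {s : ℕ} (R : RungeKutta s) (q : ℕ) : Prop :=
  ∀ v, SmoothBounded v → ∃ C δ₀ : ℝ, 0 < δ₀ ∧ ∀ (t δ : ℝ) (y : Plane) (γ : ℝ → Plane),
    |δ| ≤ δ₀ → IsPathline v γ → R.IsStep v t δ (γ t) y → ‖y - γ (t + δ)‖ ≤ C * |δ| ^ (q + 1)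

/-! ### One step of the Lagrangian remapping method, from time `t` to time `t + δ` -/

namespace PolygonalMesh

variable {Ω : Set Plane} (M : PolygonalMesh Ω)

/-- The exact preimage of the control volume `c` under the flow map. -/
def preimage (Ψ : ℝ → ℝ → Plane → Plane) (t δ : ℝ) (c : Fin M.numCells) : Set Plane :=
  Ψ t (t + δ) ⁻¹' M.cell c

/-- The polygonal representation of the preimage: its exact corners, joined by segments. -/
def preimageRep (Ψ : ℝ → ℝ → Plane → Plane) (t δ : ℝ) (c : Fin M.numCells) : Set Plane :=
  polygonRegion fun i => Ψ (t + δ) t (M.corner c i)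

/-- The approximate preimage: the polygon whose corners are the approximate positions `p c i`. -/
def preimageApprox (p : (c : Fin M.numCells) → ZMod (M.numCorners c) → Plane)
    (c : Fin M.numCells) : Set Plane :=
  polygonRegion (p c)

/-- The approximate positions `p c i` result from integrating backwards in time, from `t + δ` to
`t`, starting in the corners of the control volumes, by one step of the method `R` applied to the
interpolated velocity field. -/
def IsBacktraced {s : ℕ} (R : RungeKutta s) {ρ Λ : ℝ} (I : StaggeredInterpolation ρ Λ M.size)
    (u : ℝ → Plane → Plane) (t δ : ℝ)
    (p : (c : Fin M.numCells) → ZMod (M.numCorners c) → Plane) : Prop :=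
  ∀ c i, R.IsStep (I.field u t δ) (t + δ) (-δ) (M.corner c i) (p c i)

/-- The exact volume fractions at the new time `t + δ`, where `L` is the liquid domain at time `t`,
so that `Ψ t (t + δ) '' L` is the liquid domain at time `t + δ`. -/
def volumeFraction (Ψ : ℝ → ℝ → Plane → Plane) (t δ : ℝ) (L : Set Plane)
    (c : Fin M.numCells) : ℝ :=
  M0 (M.cell c ∩ Ψ t (t + δ) '' L) / M0 (M.cell c)

/-- The volume fractions at the new time computed by the approximate remapping, where `Lapprox c` is
the approximation of the liquid neighbourhood around `c` at the old time. -/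
def volumeFractionApprox (p : (c : Fin M.numCells) → ZMod (M.numCorners c) → Plane)
    (Lapprox : Fin M.numCells → Set Plane) (c : Fin M.numCells) : ℝ :=
  M0 (M.preimageApprox p c ∩ Lapprox c) / M0 (M.cell c)

/-- The reconstruction error. -/
def errorRec (L : Set Plane) (Lapprox : Fin M.numCells → Set Plane) (c : Fin M.numCells) : ℝ :=
  M0 (symmDiff (Lapprox c) (L ∩ M.neighbourhood c))

/-- The polygonal representation error. -/
def errorRep (Ψ : ℝ → ℝ → Plane → Plane) (t δ : ℝ) (c : Fin M.numCells) : ℝ :=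
  M0 (symmDiff (M.preimageRep Ψ t δ c) (M.preimage Ψ t δ c))

/-- The integration error. -/
def errorInt (Ψ : ℝ → ℝ → Plane → Plane) (t δ : ℝ)
    (p : (c : Fin M.numCells) → ZMod (M.numCorners c) → Plane) (c : Fin M.numCells) : ℝ :=
  M0 (symmDiff (M.preimageApprox p c) (M.preimageRep Ψ t δ c))

end PolygonalMesh

end

noncomputable section

/-! The flow of a divergence-free field preserves area, so the liquid in `c` at the new time has the
area of the preimage of `c` intersected with the old liquid. Under the CFL condition a particle
moves by at most `σ h`, so up to a null set this liquid comes from the neighbours of `c`. The exact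
and the approximate intersection then differ only inside three symmetric differences and a null set
(`abs_M0_inter_sub_le`). These are the three errors, to be divided by an area of at least `κ h ^ 2`.

A polygonal region consists of the points off which its boundary loop cannot be contracted. Hence
the exact preimage is the region of the image curve (`preimage_eq`), and loops that are uniformly
`ε`-close have the same region outside an `ε`-tube (`symmDiff_polygonRegion_subset`). For at most
`N` edges of length `O(h)` and `ε = O(h)` this tube has area `O(ε h)`, so only `ε` is needed. In a
time `δ = O(h)` the image of an edge leaves its chord by `O(h ^ 2 δ) = O(h ^ 3)` (`flow_lineMap`).
The corners are misplaced by `O(h ^ 3 + h ^ (q + 1))`: an interpolation error `O(h ^ 2)` of the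
velocity acts during the time `δ`, and the Runge–Kutta error is added.

Area preservation is obtained without differentiating the flow in its initial point. A flow of
duration `ε` is an Euler step, whose Jacobian is at most `1 + O(ε ^ 2)` because the trace vanishes,
followed by a map with Lipschitz constant `1 + O(ε ^ 2)`. Over `n` steps of size `O(1 / n)` the area
factor is `exp (O(1 / n))`, which tends to `1`. -/

/-! ### Functions with bounded and Lipschitz derivative -/

section BoundedC11

variable {E G : Type*} [NormedAddCommGroup E] [NormedSpace ℝ E] [NormedAddCommGroup G]
  [NormedSpace ℝ G]

/-- `F` is differentiable, and its derivative is bounded by `B` and `B`-Lipschitz. -/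
structure BoundedC11 (F : E → G) (B : ℝ) : Prop where
  nonneg : 0 ≤ B
  differentiable : Differentiable ℝ F
  norm_fderiv_le : ∀ z, ‖fderiv ℝ F z‖ ≤ B
  norm_fderiv_sub_le : ∀ z w, ‖fderiv ℝ F z - fderiv ℝ F w‖ ≤ B * ‖z - w‖

theorem SmoothBounded.exists_boundedC11 {u : ℝ → Plane → Plane} (hu : SmoothBounded u) :
    ∃ B, BoundedC11 (Function.uncurry u) B := by
  obtain ⟨hs, hb⟩ := hu
  obtain ⟨B₁, h₁⟩ := hb 1
  obtain ⟨B₂, h₂⟩ := hb 2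
  have n₁ : 0 ≤ B₁ := (norm_nonneg _).trans (h₁ 0)
  have n₂ : 0 ≤ B₂ := (norm_nonneg _).trans (h₂ 0)
  refine ⟨max B₁ B₂, le_max_of_le_left n₁, hs.differentiable (by simp), fun z => ?_,
    fun z w => ?_⟩
  · rw [← norm_iteratedFDeriv_one]
    exact (h₁ z).trans (le_max_left _ _)
  · refine (Convex.norm_image_sub_le_of_norm_fderiv_le (𝕜 := ℝ) (C := B₂) (fun x _ => ?_)
      (fun x _ => ?_) convex_univ (Set.mem_univ w) (Set.mem_univ z)).trans
        (mul_le_mul_of_nonneg_right (le_max_right _ _) (norm_nonneg _))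
    · exact ((contDiff_infty.1 hs 2).fderiv_right (m := 1) (by norm_num)).differentiable (by simp) x
    · rw [← norm_iteratedFDeriv_one, norm_iteratedFDeriv_fderiv]
      exact h₂ x

namespace BoundedC11

variable {F : E → G} {B : ℝ} (hF : BoundedC11 F B)
include hF

theorem norm_sub_le (z w : E) : ‖F z - F w‖ ≤ B * ‖z - w‖ :=
  Convex.norm_image_sub_le_of_norm_fderiv_le (𝕜 := ℝ) (fun x _ => hF.differentiable x)
    (fun x _ => hF.norm_fderiv_le x) convex_univ (Set.mem_univ w) (Set.mem_univ z)

theorem norm_taylor_le (z w : E) : ‖F w - F z - fderiv ℝ F z (w - z)‖ ≤ B * ‖w - z‖ ^ 2 := by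
  have := (convex_segment (𝕜 := ℝ) z w).norm_image_sub_le_of_norm_fderiv_le' (𝕜 := ℝ) (f := F)
    (φ := fderiv ℝ F z) (C := B * ‖w - z‖) (fun x _ => hF.differentiable x) (fun x hx => ?_)
    (left_mem_segment ℝ z w) (right_mem_segment ℝ z w)
  · rwa [mul_assoc, ← pow_two] at this
  · refine (hF.norm_fderiv_sub_le _ _).trans (mul_le_mul_of_nonneg_left ?_ hF.nonneg)
    obtain ⟨θ, hθ, rfl⟩ := segment_eq_image' ℝ z w ▸ hx
    simp only [add_sub_cancel_left, norm_smul, Real.norm_eq_abs, abs_of_nonneg hθ.1]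
    exact mul_le_of_le_one_left (norm_nonneg _) hθ.2

/-- Weighted sums which reproduce affine functions are accurate to second order. -/
theorem norm_sum_smul_sub_le {ι : Type*} (S : Finset ι) (w : ι → ℝ) (p : ι → E) (x : E)
    (hw : ∑ i ∈ S, w i = 1) (hx : ∑ i ∈ S, w i • p i = x) :
    ‖∑ i ∈ S, w i • F (p i) - F x‖ ≤ ∑ i ∈ S, |w i| * (B * ‖p i - x‖ ^ 2) := by
  have h0 : ∑ i ∈ S, w i • (p i - x) = 0 := by
    simp_rw [smul_sub, Finset.sum_sub_distrib, ← Finset.sum_smul, hw, hx, one_smul, sub_self]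
  have h1 : ∑ i ∈ S, w i • F (p i) - F x
      = ∑ i ∈ S, w i • (F (p i) - F x - fderiv ℝ F x (p i - x)) := by
    simp_rw [smul_sub (w _) (F _ - F _), smul_sub (w _) (F _) (F _), Finset.sum_sub_distrib,
      ← Finset.sum_smul, hw, one_smul, ← map_smul, ← map_sum, h0, map_zero, sub_zero]
  rw [h1]
  refine (norm_sum_le _ _).trans (Finset.sum_le_sum fun i _ => ?_)
  rw [norm_smul, Real.norm_eq_abs]
  exact mul_le_mul_of_nonneg_left (hF.norm_taylor_le _ _) (abs_nonneg _)

theorem norm_lineMap_sub_le (a b : E) {θ : ℝ} (hθ : θ ∈ Set.Icc (0 : ℝ) 1) :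
    ‖AffineMap.lineMap (F a) (F b) θ - F (AffineMap.lineMap a b θ)‖ ≤ B * ‖a - b‖ ^ 2 := by
  have h := hF.norm_sum_smul_sub_le Finset.univ ![1 - θ, θ] ![a, b] (AffineMap.lineMap a b θ)
    (by simp) (by simp [AffineMap.lineMap_apply_module])
  simp only [Fin.sum_univ_two, Matrix.cons_val_zero, Matrix.cons_val_one] at h
  rw [AffineMap.lineMap_apply_module]
  refine h.trans ?_
  have e1 : ‖a - AffineMap.lineMap a b θ‖ ≤ ‖a - b‖ := by
    rw [← dist_eq_norm, dist_left_lineMap, Real.norm_eq_abs, abs_of_nonneg hθ.1, dist_eq_norm]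
    exact mul_le_of_le_one_left (norm_nonneg _) hθ.2
  have e2 : ‖b - AffineMap.lineMap a b θ‖ ≤ ‖a - b‖ := by
    rw [← dist_eq_norm, dist_right_lineMap, Real.norm_eq_abs,
      abs_of_nonneg (sub_nonneg.2 hθ.2), dist_eq_norm]
    exact mul_le_of_le_one_left (norm_nonneg _) (by linarith [hθ.1])
  rw [abs_of_nonneg hθ.1, abs_of_nonneg (sub_nonneg.2 hθ.2)]
  have hB := hF.nonneg
  have h1 := sub_nonneg.2 hθ.2
  have h2 := hθ.1
  calc _ ≤ (1 - θ) * (B * ‖a - b‖ ^ 2) + θ * (B * ‖a - b‖ ^ 2) := by gcongr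
    _ = _ := by ring

/-- Both segments are traversed with the same parameter. Corresponding points stay within `m`, so
the derivative of `F` varies by at most `B * m` between them. Each term is a first-order difference,
which is what makes the later flow estimate proportional to `‖x - y‖`. -/
theorem norm_second_diff_le (a b c d : E) {m : ℝ} (hac : ‖a - c‖ ≤ m) (hbd : ‖b - d‖ ≤ m) :
    ‖(F a - F b) - (F c - F d)‖ ≤ B * ‖(a - b) - (c - d)‖ + B * m * ‖c - d‖ := by
  have hd : ∀ (a b : E) (r : ℝ), HasDerivAt (fun r : ℝ => F (b + r • (a - b)))
      (fderiv ℝ F (b + r • (a - b)) (a - b)) r := fun a b r => by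
    have h := ((hasDerivAt_id r).smul_const (a - b)).const_add b
    rw [one_smul] at h
    exact (hF.differentiable _).hasFDerivAt.comp_hasDerivAt r h
  have key := norm_image_sub_le_of_norm_deriv_le_segment_01'
    (f := fun r : ℝ => F (b + r • (a - b)) - F (d + r • (c - d)))
    (f' := fun r => fderiv ℝ F (b + r • (a - b)) (a - b) - fderiv ℝ F (d + r • (c - d)) (c - d))
    (C := B * ‖(a - b) - (c - d)‖ + B * m * ‖c - d‖)
    (fun r _ => ((hd a b r).sub (hd c d r)).hasDerivWithinAt) (fun r hr => ?_)
  · simp only [one_smul, add_sub_cancel, zero_smul, add_zero] at key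
    rwa [sub_sub_sub_comm] at key
  · set P := b + r • (a - b)
    set Q := d + r • (c - d)
    have e : fderiv ℝ F P (a - b) - fderiv ℝ F Q (c - d)
        = fderiv ℝ F P ((a - b) - (c - d)) + (fderiv ℝ F P - fderiv ℝ F Q) (c - d) := by
      simp only [map_sub, sub_apply]; abel
    have hPQ : ‖P - Q‖ ≤ m := by
      have : P - Q = (1 - r) • (b - d) + r • (a - c) := by
        simp only [P, Q]; module
      rw [this]
      refine (norm_add_le _ _).trans ?_
      rw [norm_smul, norm_smul, Real.norm_eq_abs, Real.norm_eq_abs, abs_of_nonneg hr.1,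
        abs_of_nonneg (sub_nonneg.2 hr.2.le)]
      have h1 := sub_nonneg.2 hr.2.le
      have h2 := hr.1
      calc _ ≤ (1 - r) * m + r * m := by gcongr
        _ = m := by ring
    rw [e]
    refine (norm_add_le _ _).trans (add_le_add ?_ ?_)
    · exact (ContinuousLinearMap.le_opNorm _ _).trans
        (mul_le_mul_of_nonneg_right (hF.norm_fderiv_le _) (norm_nonneg _))
    · refine (ContinuousLinearMap.le_opNorm _ _).trans
        (mul_le_mul_of_nonneg_right ?_ (norm_nonneg _))
      exact (hF.norm_fderiv_sub_le _ _).trans (mul_le_mul_of_nonneg_left hPQ hF.nonneg)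

end BoundedC11

end BoundedC11

/-! ### Grönwall's inequality in both time directions -/

/-- This follows from `1 - K x ≤ exp (-K x)`. There is no division by `K`, so the same form covers
`K = 0`, where Grönwall's inequality is plain integration. -/
theorem gronwallBound_le {a K c x : ℝ} (hK : 0 ≤ K) (hc : 0 ≤ c) :
    gronwallBound a K c x ≤ (a + c * x) * Real.exp (K * x) := by
  rcases hK.eq_or_lt with rfl | hK
  · simp [gronwallBound_K0]
  · rw [gronwallBound_of_K_ne_0 hK.ne']
    have h1 : Real.exp (K * x) - 1 ≤ K * x * Real.exp (K * x) := by
      have h2 := Real.add_one_le_exp (-(K * x))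
      have h3 : Real.exp (-(K * x)) * Real.exp (K * x) = 1 := by rw [← Real.exp_add]; simp
      nlinarith [Real.exp_pos (K * x)]
    calc _ ≤ a * Real.exp (K * x) + c / K * (K * x * Real.exp (K * x)) :=
          add_le_add_right (mul_le_mul_of_nonneg_left h1 (by positivity)) _
      _ = _ := by field_simp

section Gronwall

variable {E : Type*} [NormedAddCommGroup E] [NormedSpace ℝ E]

theorem norm_le_of_norm_deriv_le_of_le {f f' : ℝ → E} {K c s t : ℝ} (hK : 0 ≤ K) (hc : 0 ≤ c)
    (hst : s ≤ t) (hf : ∀ r, HasDerivAt f (f' r) r)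
    (hb : ∀ r ∈ Set.Icc s t, ‖f' r‖ ≤ K * ‖f r‖ + c) :
    ‖f t‖ ≤ (‖f s‖ + c * (t - s)) * Real.exp (K * (t - s)) :=
  (norm_le_gronwallBound_of_norm_deriv_right_le (δ := ‖f s‖) (K := K) (ε := c)
    (fun r _ => (hf r).continuousAt.continuousWithinAt) (fun r _ => (hf r).hasDerivWithinAt) le_rfl
    (fun r hr => hb r (Set.Ico_subset_Icc_self hr)) t ⟨hst, le_rfl⟩).trans
      (gronwallBound_le hK hc)

theorem norm_le_of_norm_deriv_le {f f' : ℝ → E} {K c s t : ℝ} (hK : 0 ≤ K) (hc : 0 ≤ c)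
    (hf : ∀ r, HasDerivAt f (f' r) r) (hb : ∀ r ∈ Set.uIcc s t, ‖f' r‖ ≤ K * ‖f r‖ + c) :
    ‖f t‖ ≤ (‖f s‖ + c * |t - s|) * Real.exp (K * |t - s|) := by
  rcases le_total s t with h | h
  · rw [abs_of_nonneg (sub_nonneg.2 h)]
    rw [Set.uIcc_of_le h] at hb
    exact norm_le_of_norm_deriv_le_of_le hK hc h hf hb
  · rw [abs_of_nonpos (sub_nonpos.2 h)]
    rw [Set.uIcc_of_ge h] at hb
    -- Reversing time reduces this case to the forward one.
    have := norm_le_of_norm_deriv_le_of_le (f := fun r => f (-r)) (f' := fun r => -f' (-r))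
      (s := -s) (t := -t) hK hc (neg_le_neg h)
      (fun r => by simpa [Function.comp_def] using (hf (-r)).scomp r (hasDerivAt_neg r))
      (fun r hr => by
        rw [norm_neg]
        exact hb (-r) ⟨by linarith [hr.2], by linarith [hr.1]⟩)
    simp only [neg_neg] at this
    rwa [show -(t - s) = -t - -s by ring]

end Gronwall

/-! ### The flow map -/

theorem Set.abs_sub_le_of_mem_uIcc {s t r : ℝ} (hr : r ∈ Set.uIcc s t) : |r - s| ≤ |t - s| := by
  have := Set.abs_sub_left_of_mem_uIcc hr
  simpa using this

theorem norm_prodMk_sub_prodMk {τ : ℝ} (x y : Plane) :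
    ‖((τ, x) : ℝ × Plane) - (τ, y)‖ = ‖x - y‖ := by
  simp [Prod.norm_def]

namespace BoundedC11

variable {u : ℝ → Plane → Plane} {B : ℝ} (hF : BoundedC11 (Function.uncurry u) B)
include hF

theorem velocity_lipschitz (t : ℝ) (x y : Plane) : ‖u t x - u t y‖ ≤ B * ‖x - y‖ := by
  have := hF.norm_sub_le (t, x) (t, y)
  rwa [norm_prodMk_sub_prodMk] at this

theorem velocity_lineMap (t : ℝ) (x y : Plane) {θ : ℝ} (hθ : θ ∈ Set.Icc (0 : ℝ) 1) :
    ‖AffineMap.lineMap (u t x) (u t y) θ - u t (AffineMap.lineMap x y θ)‖ ≤ B * ‖x - y‖ ^ 2 := by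
  have := hF.norm_lineMap_sub_le (t, x) (t, y) hθ
  rw [norm_prodMk_sub_prodMk] at this
  have e : AffineMap.lineMap ((t, x) : ℝ × Plane) (t, y) θ = (t, AffineMap.lineMap x y θ) := by
    simp [AffineMap.lineMap_apply]
  rwa [e] at this

/-- With equal values at time `s` this is uniqueness of pathlines, from which the composition law of
the flow follows. -/
theorem pathline_dist {γ η : ℝ → Plane} (hγ : IsPathline u γ) (hη : IsPathline u η) (s t : ℝ) :
    ‖γ t - η t‖ ≤ ‖γ s - η s‖ * Real.exp (B * |t - s|) := by
  have := norm_le_of_norm_deriv_le (f := fun r => γ r - η r) (s := s) (t := t) hF.nonneg le_rfl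
    (fun r => (hγ r).sub (hη r)) (fun r _ => by
      simpa using hF.velocity_lipschitz r (γ r) (η r))
  simpa using this

variable {Ψ : ℝ → ℝ → Plane → Plane} (hΨ : IsFlowMap u Ψ)
include hΨ

theorem flow_lipschitz (s t : ℝ) (x y : Plane) :
    ‖Ψ s t x - Ψ s t y‖ ≤ ‖x - y‖ * Real.exp (B * |t - s|) := by
  have := hF.pathline_dist (hΨ s x).2 (hΨ s y).2 s t
  simpa only [(hΨ s x).1, (hΨ s y).1] using this

theorem flow_trans (s t r : ℝ) (x : Plane) : Ψ t r (Ψ s t x) = Ψ s r x := by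
  have := hF.pathline_dist (hΨ t (Ψ s t x)).2 (hΨ s x).2 t r
  simp only [(hΨ t (Ψ s t x)).1, sub_self, norm_zero, zero_mul] at this
  exact sub_eq_zero.1 (norm_le_zero_iff.1 this)

theorem flow_flow_cancel (s t : ℝ) (x : Plane) : Ψ t s (Ψ s t x) = x := by
  rw [hF.flow_trans hΨ, (hΨ s x).1]

theorem continuous_flow (s t : ℝ) : Continuous (Ψ s t) := by
  refine (LipschitzWith.of_dist_le' (K := Real.exp (B * |t - s|)) fun x y => ?_).continuous
  rw [dist_eq_norm, dist_eq_norm, mul_comm]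
  exact hF.flow_lipschitz hΨ s t x y

/-- The flow map between two times, as a homeomorphism. -/
def flowHomeomorph (s t : ℝ) : Plane ≃ₜ Plane where
  toFun := Ψ s t
  invFun := Ψ t s
  left_inv := hF.flow_flow_cancel hΨ s t
  right_inv := hF.flow_flow_cancel hΨ t s
  continuous_toFun := hF.continuous_flow hΨ s t
  continuous_invFun := hF.continuous_flow hΨ t s

omit hF in
theorem _root_.IsFlowMap.norm_sub_le {U : ℝ} (hU : 0 ≤ U) (huU : ∀ t x, ‖u t x‖ ≤ U) (s t : ℝ)
    (x : Plane) : ‖Ψ s t x - x‖ ≤ U * |t - s| := by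
  have := norm_le_of_norm_deriv_le (f := fun r => Ψ s r x - x) (s := s) (t := t) le_rfl hU
    (fun r => ((hΨ s x).2 r).sub_const x) (fun r _ => by simpa using huU r (Ψ s r x))
  simpa [(hΨ s x).1] using this

/-- The moving point and the moving chord start together. Their velocities differ by a Lipschitz
term in the current gap plus the second-order error of interpolating `u` along the chord, and
Grönwall's inequality applies. -/
theorem flow_lineMap (s t : ℝ) (hst : |t - s| ≤ 1) (x y : Plane) {θ : ℝ}
    (hθ : θ ∈ Set.Icc (0 : ℝ) 1) :
    ‖Ψ s t (AffineMap.lineMap x y θ) - AffineMap.lineMap (Ψ s t x) (Ψ s t y) θ‖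
      ≤ B * Real.exp B ^ 3 * ‖x - y‖ ^ 2 * |t - s| := by
  set z := AffineMap.lineMap x y θ with hz
  have hB := hF.nonneg
  have hexp : ∀ r ∈ Set.uIcc s t, Real.exp (B * |r - s|) ≤ Real.exp B := fun r hr =>
    Real.exp_le_exp.2 (mul_le_of_le_one_right hB ((Set.abs_sub_le_of_mem_uIcc hr).trans hst))
  have hd : ∀ r, HasDerivAt
      (fun r => Ψ s r z - AffineMap.lineMap (Ψ s r x) (Ψ s r y) θ)
      (u r (Ψ s r z) - AffineMap.lineMap (u r (Ψ s r x)) (u r (Ψ s r y)) θ) r := fun r => by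
    simp only [AffineMap.lineMap_apply_module]
    exact ((hΨ s z).2 r).sub
      ((((hΨ s x).2 r).const_smul (1 - θ)).add (((hΨ s y).2 r).const_smul θ))
  have := norm_le_of_norm_deriv_le (s := s) (t := t) (K := B)
    (c := B * (‖x - y‖ * Real.exp B) ^ 2) hB (by positivity) hd (fun r hr => by
      set X := Ψ s r x
      set Y := Ψ s r y
      have h1 := hF.velocity_lipschitz r (Ψ s r z) (AffineMap.lineMap X Y θ)
      have h2 := hF.velocity_lineMap r X Y hθ
      have h3 : ‖X - Y‖ ≤ ‖x - y‖ * Real.exp B :=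
        (hF.flow_lipschitz hΨ s r x y).trans
          (mul_le_mul_of_nonneg_left (hexp r hr) (norm_nonneg _))
      rw [norm_sub_rev] at h2
      calc _ ≤ _ := norm_sub_le_norm_sub_add_norm_sub _ (u r (AffineMap.lineMap X Y θ)) _
        _ ≤ _ := add_le_add h1 (h2.trans (by gcongr)))
  simp only [(hΨ s _).1] at this
  rw [← hz, sub_self, norm_zero, zero_add] at this
  have h4 := hexp t Set.right_mem_uIcc
  calc _ ≤ _ := this
    _ ≤ B * (‖x - y‖ * Real.exp B) ^ 2 * |t - s| * Real.exp B := by gcongr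
    _ = _ := by ring

/-- The flow minus its Euler step has Lipschitz constant `O((t - s) ^ 2)`: its increments have as
time derivative a second difference of `u`, which is `O(|t - s|) * ‖x - y‖`, and integration
supplies the other factor. -/
theorem flow_second_diff {U : ℝ} (hU : 0 ≤ U) (huU : ∀ t x, ‖u t x‖ ≤ U) (s t : ℝ)
    (hst : |t - s| ≤ 1) (x y : Plane) :
    ‖(Ψ s t x - Ψ s t y) - ((x - y) + (t - s) • (u s x - u s y))‖
      ≤ B * (B * Real.exp B + 1 + U) * (t - s) ^ 2 * ‖x - y‖ := by
  have hB := hF.nonneg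
  have hexp : ∀ r ∈ Set.uIcc s t, Real.exp (B * |r - s|) ≤ Real.exp B := fun r hr =>
    Real.exp_le_exp.2 (mul_le_of_le_one_right hB ((Set.abs_sub_le_of_mem_uIcc hr).trans hst))
  have hd : ∀ r, HasDerivAt
      (fun r => (Ψ s r x - Ψ s r y) - ((x - y) + (r - s) • (u s x - u s y)))
      ((u r (Ψ s r x) - u r (Ψ s r y)) - (u s x - u s y)) r := fun r => by
    have h := (((hasDerivAt_id r).sub_const s).smul_const (u s x - u s y)).const_add (x - y)
    rw [one_smul] at h
    exact (((hΨ s x).2 r).sub ((hΨ s y).2 r)).sub h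
  have hincr : ∀ r ∈ Set.uIcc s t,
      ‖(Ψ s r x - Ψ s r y) - (x - y)‖ ≤ B * Real.exp B * ‖x - y‖ * |t - s| := fun r hr => by
    have := norm_le_of_norm_deriv_le (f := fun r => (Ψ s r x - Ψ s r y) - (x - y)) (s := s)
      (t := r) (K := 0) (c := B * (‖x - y‖ * Real.exp B)) le_rfl (by positivity)
      (fun r => (((hΨ s x).2 r).sub ((hΨ s y).2 r)).sub_const _) (fun r' hr' => by
        rw [zero_mul, zero_add]
        refine (hF.velocity_lipschitz _ _ _).trans (mul_le_mul_of_nonneg_left ?_ hB)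
        exact (hF.flow_lipschitz hΨ s r' x y).trans (mul_le_mul_of_nonneg_left
          (hexp r' (Set.uIcc_subset_uIcc_left hr hr')) (norm_nonneg _)))
    simp only [(hΨ s _).1, sub_self, norm_zero, zero_add, zero_mul, Real.exp_zero, mul_one] at this
    refine this.trans ?_
    have := Set.abs_sub_le_of_mem_uIcc hr
    calc _ ≤ B * (‖x - y‖ * Real.exp B) * |t - s| := by gcongr
      _ = _ := by ring
  have := norm_le_of_norm_deriv_le (s := s) (t := t) (K := 0)
    (c := B * (B * Real.exp B + 1 + U) * |t - s| * ‖x - y‖) le_rfl (by positivity) hd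
    (fun r hr => by
      have hrs := Set.abs_sub_le_of_mem_uIcc hr
      have hm : ∀ z, ‖((r, Ψ s r z) : ℝ × Plane) - (s, z)‖ ≤ (1 + U) * |t - s| := fun z => by
        rw [Prod.mk_sub_mk, Prod.norm_mk, Real.norm_eq_abs]
        refine max_le ?_ ?_
        · nlinarith [abs_nonneg (t - s)]
        · refine (hΨ.norm_sub_le hU huU s r z).trans ?_
          nlinarith [abs_nonneg (t - s)]
      have h := hF.norm_second_diff_le (r, Ψ s r x) (r, Ψ s r y) (s, x) (s, y) (hm x) (hm y)
      have e : ((r, Ψ s r x) : ℝ × Plane) - (r, Ψ s r y) - ((s, x) - (s, y))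
          = (0, Ψ s r x - Ψ s r y) - (0, x - y) := by simp
      rw [norm_prodMk_sub_prodMk, e, norm_prodMk_sub_prodMk] at h
      refine h.trans ?_
      rw [zero_mul, zero_add]
      have := hincr r hr
      calc _ ≤ B * (B * Real.exp B * ‖x - y‖ * |t - s|) + B * ((1 + U) * |t - s|) * ‖x - y‖ := by
            gcongr
        _ = _ := by ring)
  simp only [(hΨ s _).1, sub_self, zero_smul, add_zero, norm_zero, zero_add, zero_mul,
    Real.exp_zero, mul_one] at this
  refine this.trans (le_of_eq ?_)
  rw [← sq_abs (t - s)]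
  ring

end BoundedC11

/-! ### The flow map of a divergence-free velocity field preserves area -/

open scoped NNReal ENNReal

/-- Two-dimensional Hausdorff measure obeys this scaling and is a Haar measure, so Lebesgue measure
is a multiple of it. -/
theorem LipschitzOnWith.volume_image_le {f : Plane → Plane} {S : Set Plane} {K : ℝ≥0}
    (h : LipschitzOnWith K f S) : volume (f '' S) ≤ (K : ℝ≥0∞) ^ 2 * volume S := by
  have : Measure.IsAddHaarMeasure (Measure.hausdorffMeasure 2 : Measure Plane) := by
    simpa using isAddHaarMeasure_hausdorffMeasure (E := Plane)
  rw [Measure.isAddLeftInvariant_eq_smul (volume : Measure Plane) (Measure.hausdorffMeasure 2),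
    Measure.smul_apply, Measure.smul_apply, ENNReal.smul_def, ENNReal.smul_def, smul_eq_mul,
    smul_eq_mul, mul_left_comm]
  gcongr
  simpa using h.hausdorffMeasure_image_le (d := 2) (by norm_num)

/-- In the plane the determinant is `1 + ε tr A + ε ^ 2 det A`, and the trace is zero. -/
theorem abs_det_one_add_smul_le {A : Plane →L[ℝ] Plane}
    (hA : ∑ i : Fin 2, (A (EuclideanSpace.single i 1)) i = 0) {B : ℝ} (hB : ‖A‖ ≤ B) (ε : ℝ) :
    |(ContinuousLinearMap.id ℝ Plane + ε • A).det| ≤ 1 + 2 * B ^ 2 * ε ^ 2 := by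
  have hB0 : 0 ≤ B := (norm_nonneg _).trans hB
  have hent : ∀ i j, |(A (EuclideanSpace.single j 1)) i| ≤ B := fun i j => by
    refine (PiLp.norm_apply_le (A (EuclideanSpace.single j 1)) i).trans ?_
    refine (A.le_opNorm _).trans ?_
    simpa using hB
  rw [Fin.sum_univ_two] at hA
  have hdet : (ContinuousLinearMap.id ℝ Plane + ε • A).det
      = 1 + ε ^ 2 * ((A (EuclideanSpace.single 0 1)) 0 * (A (EuclideanSpace.single 1 1)) 1
        - (A (EuclideanSpace.single 1 1)) 0 * (A (EuclideanSpace.single 0 1)) 1) := by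
    rw [ContinuousLinearMap.det,
      ← LinearMap.det_toMatrix (EuclideanSpace.basisFun (Fin 2) ℝ).toBasis, Matrix.det_fin_two]
    simp [LinearMap.toMatrix_apply]
    linear_combination ε * hA
  rw [hdet]
  set a := (A (EuclideanSpace.single 0 1)) 0 * (A (EuclideanSpace.single 1 1)) 1
  set b := (A (EuclideanSpace.single 1 1)) 0 * (A (EuclideanSpace.single 0 1)) 1
  have ha : |a| ≤ B * B := by
    rw [abs_mul]; exact mul_le_mul (hent _ _) (hent _ _) (abs_nonneg _) hB0
  have hb : |b| ≤ B * B := by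
    rw [abs_mul]; exact mul_le_mul (hent _ _) (hent _ _) (abs_nonneg _) hB0
  have hab : |a - b| ≤ 2 * B ^ 2 := by
    have := abs_sub a b
    linarith
  calc |1 + ε ^ 2 * (a - b)| ≤ |1| + |ε ^ 2 * (a - b)| := abs_add_le _ _
    _ = 1 + ε ^ 2 * |a - b| := by rw [abs_one, abs_mul, abs_of_nonneg (sq_nonneg ε)]
    _ ≤ 1 + ε ^ 2 * (2 * B ^ 2) := by gcongr
    _ = _ := by ring

namespace BoundedC11

variable {u : ℝ → Plane → Plane} {B : ℝ} (hF : BoundedC11 (Function.uncurry u) B)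
include hF

theorem hasFDerivAt_velocity (t : ℝ) (x : Plane) : HasFDerivAt (u t) (fderiv ℝ (u t) x) x := by
  have h : DifferentiableAt ℝ (fun y => Function.uncurry u (t, y)) x :=
    (hF.differentiable (t, x)).comp x (by fun_prop)
  exact h.hasFDerivAt

theorem norm_fderiv_velocity_le (t : ℝ) (x : Plane) : ‖fderiv ℝ (u t) x‖ ≤ B :=
  norm_fderiv_le_of_lipschitz (C := ⟨B, hF.nonneg⟩) ℝ (LipschitzWith.of_dist_le_mul fun x y => by
    rw [dist_eq_norm, dist_eq_norm]; exact hF.velocity_lipschitz t x y)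

theorem volume_image_euler_step_le (hdiv : DivergenceFree u) (s ε : ℝ) {S : Set Plane}
    (hS : MeasurableSet S) :
    volume ((fun x => x + ε • u s x) '' S)
      ≤ ENNReal.ofReal (Real.exp (2 * B ^ 2 * ε ^ 2)) * volume S := by
  refine (addHaar_image_le_lintegral_abs_det_fderiv volume hS
    (f' := fun x => ContinuousLinearMap.id ℝ Plane + ε • fderiv ℝ (u s) x) (fun x _ =>
      ((hasFDerivAt_id x).add ((hF.hasFDerivAt_velocity s x).const_smul ε)).hasFDerivWithinAt)).trans
        ?_
  rw [← setLIntegral_const]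
  refine lintegral_mono fun x => ENNReal.ofReal_le_ofReal ?_
  refine (abs_det_one_add_smul_le (hdiv s x) (hF.norm_fderiv_velocity_le s x) ε).trans ?_
  rw [add_comm]
  exact Real.add_one_le_exp _

variable {Ψ : ℝ → ℝ → Plane → Plane} (hΨ : IsFlowMap u Ψ)
include hΨ

/-- The flow is factored as `G ∘ F` with `F` the Euler step. The constant collects `4 * D` from
squaring the Lipschitz constant `exp (2 * D * ε ^ 2)` of `G` and `2 * B ^ 2` from the Jacobian of
`F`. -/
theorem exists_volume_image_flow_step_le (hdiv : DivergenceFree u) {U : ℝ} (hU : 0 ≤ U)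
    (huU : ∀ t x, ‖u t x‖ ≤ U) :
    ∃ C : ℝ, ∀ s ε : ℝ, |ε| ≤ 1 → |ε| * B ≤ 1 / 2 → ∀ S : Set Plane, MeasurableSet S →
      volume (Ψ s (s + ε) '' S) ≤ ENNReal.ofReal (Real.exp (C * ε ^ 2)) * volume S := by
  have hB := hF.nonneg
  set D := B * (B * Real.exp B + 1 + U) with hD
  have hD0 : 0 ≤ D := by positivity
  refine ⟨4 * D + 2 * B ^ 2, fun s ε hε hεB S hS => ?_⟩
  set F : Plane → Plane := fun x => x + ε • u s x with hFdef
  -- For `|ε| * B ≤ 1 / 2` the Euler step shrinks distances at most by half, so it can be inverted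
  -- on its image.
  have hanti : ∀ x y, ‖x - y‖ ≤ 2 * ‖F x - F y‖ := fun x y => by
    have h1 : x - y = (F x - F y) - ε • (u s x - u s y) := by simp only [hFdef]; module
    have h2 : ‖x - y‖ ≤ ‖F x - F y‖ + |ε| * (B * ‖x - y‖) := by
      calc ‖x - y‖ = ‖(F x - F y) - ε • (u s x - u s y)‖ := by rw [← h1]
        _ ≤ ‖F x - F y‖ + ‖ε • (u s x - u s y)‖ := _root_.norm_sub_le _ _
        _ ≤ _ := by
          rw [norm_smul, Real.norm_eq_abs]
          exact add_le_add_right (mul_le_mul_of_nonneg_left (hF.velocity_lipschitz s x y)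
            (abs_nonneg _)) _
    nlinarith [norm_nonneg (x - y)]
  have hinj : Function.Injective F := fun x y hxy => by
    have := hanti x y
    rw [hxy, sub_self, norm_zero, mul_zero] at this
    exact sub_eq_zero.1 (norm_le_zero_iff.1 this)
  have hleft := Function.leftInverse_invFun hinj
  set G := fun y => Ψ s (s + ε) (Function.invFun F y) with hG
  have himg : Ψ s (s + ε) '' S = G '' (F '' S) := by
    rw [Set.image_image]
    exact Set.image_congr fun x _ => by simp only [hG, hleft x]
  have hlip : LipschitzOnWith (Real.exp (2 * D * ε ^ 2)).toNNReal G (F '' S) := by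
    refine LipschitzOnWith.of_dist_le_mul ?_
    rintro _ ⟨x, -, rfl⟩ _ ⟨y, -, rfl⟩
    rw [Real.coe_toNNReal _ (Real.exp_pos _).le, dist_eq_norm, dist_eq_norm]
    simp only [hG, hleft x, hleft y]
    have h := hF.flow_second_diff hΨ hU huU s (s + ε) (by simpa using hε) x y
    rw [add_sub_cancel_left, ← hD] at h
    have e : (x - y) + ε • (u s x - u s y) = F x - F y := by simp only [hFdef]; module
    rw [e] at h
    have h1 := norm_le_norm_add_norm_sub' (Ψ s (s + ε) x - Ψ s (s + ε) y) (F x - F y)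
    have h2 : D * ε ^ 2 * ‖x - y‖ ≤ D * ε ^ 2 * (2 * ‖F x - F y‖) :=
      mul_le_mul_of_nonneg_left (hanti x y) (by positivity)
    have h3 := Real.add_one_le_exp (2 * D * ε ^ 2)
    nlinarith [norm_nonneg (F x - F y)]
  rw [himg]
  refine hlip.volume_image_le.trans ?_
  refine (mul_le_mul_right (hF.volume_image_euler_step_le hdiv s ε hS) _).trans (le_of_eq ?_)
  rw [← mul_assoc]
  congr 1
  rw [← ENNReal.ofReal, ← ENNReal.ofReal_pow (Real.exp_pos _).le,
    ← ENNReal.ofReal_mul (by positivity), ← Real.exp_nat_mul, ← Real.exp_add]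
  congr 2
  push_cast
  ring

theorem volume_image_flow_le (hdiv : DivergenceFree u) {U : ℝ} (hU : 0 ≤ U)
    (huU : ∀ t x, ‖u t x‖ ≤ U) (s t : ℝ) {S : Set Plane} (hS : MeasurableSet S) :
    volume (Ψ s t '' S) ≤ volume S := by
  obtain ⟨C, hC⟩ := hF.exists_volume_image_flow_step_le hΨ hdiv hU huU
  have iter : ∀ ε : ℝ, |ε| ≤ 1 → |ε| * B ≤ 1 / 2 → ∀ n : ℕ,
      volume (Ψ s (s + n * ε) '' S) ≤ ENNReal.ofReal (Real.exp (n * (C * ε ^ 2))) * volume S := by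
    intro ε h1 h2 n
    induction n with
    | zero =>
      have : Ψ s s '' S = S := by
        rw [Set.image_congr fun x _ => (hΨ s x).1, Set.image_id']
      simp [this]
    | succ n ih =>
      have e : Ψ s (s + (n + 1 : ℕ) * ε) '' S
          = Ψ (s + n * ε) (s + n * ε + ε) '' (Ψ s (s + n * ε) '' S) := by
        rw [Set.image_image]
        refine Set.image_congr fun x _ => ?_
        rw [hF.flow_trans hΨ]
        congr 1
        push_cast; ring
      rw [e]
      have hm : MeasurableSet (Ψ s (s + n * ε) '' S) :=
        (hF.flowHomeomorph hΨ s (s + n * ε)).measurableEmbedding.measurableSet_image' hS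
      refine (hC _ _ h1 h2 _ hm).trans ((mul_le_mul_right ih _).trans (le_of_eq ?_))
      rw [← mul_assoc, ← ENNReal.ofReal_mul (Real.exp_pos _).le, ← Real.exp_add]
      congr 3
      push_cast; ring
  have hlim : Filter.Tendsto
      (fun n : ℕ => ENNReal.ofReal (Real.exp (n * (C * ((t - s) / n) ^ 2))) * volume S)
      Filter.atTop (nhds (1 * volume S)) := by
    refine ENNReal.Tendsto.mul_const ?_ (Or.inl one_ne_zero)
    rw [← ENNReal.ofReal_one, ← Real.exp_zero]
    refine ENNReal.tendsto_ofReal ((Real.continuous_exp.tendsto 0).comp ?_)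
    have := tendsto_const_div_atTop_nhds_zero_nat (C * (t - s) ^ 2)
    refine this.congr' ?_
    filter_upwards [Filter.eventually_ne_atTop 0] with n hn
    have : (n : ℝ) ≠ 0 := Nat.cast_ne_zero.2 hn
    field_simp
  rw [one_mul] at hlim
  refine ge_of_tendsto hlim ?_
  have hsmall : Filter.Tendsto (fun n : ℕ => |(t - s) / n|) Filter.atTop (nhds 0) := by
    simpa using (tendsto_const_div_atTop_nhds_zero_nat (t - s)).abs
  have hsmall' : Filter.Tendsto (fun n : ℕ => |(t - s) / n| * B) Filter.atTop (nhds 0) := by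
    simpa using hsmall.mul_const B
  filter_upwards [Filter.eventually_ne_atTop 0, hsmall.eventually_le_const one_pos,
    hsmall'.eventually_le_const (one_half_pos)] with n hn h1 h2
  have := iter _ h1 h2 n
  rwa [mul_div_cancel₀ _ (Nat.cast_ne_zero.2 hn), add_sub_cancel] at this

/-- The flow in either time direction does not increase area; since the two are mutually inverse,
equality holds. -/
theorem measurePreserving_flow (hdiv : DivergenceFree u) {U : ℝ} (hU : 0 ≤ U)
    (huU : ∀ t x, ‖u t x‖ ≤ U) (s t : ℝ) :
    MeasurePreserving (hF.flowHomeomorph hΨ s t).toMeasurableEquiv volume volume := by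
  refine ⟨MeasurableEquiv.measurable _, Measure.ext fun S hS => ?_⟩
  rw [MeasurableEquiv.map_apply]
  change volume (hF.flowHomeomorph hΨ s t ⁻¹' S) = _
  have h1 : (hF.flowHomeomorph hΨ s t ⁻¹' S) = Ψ t s '' S :=
    ((hF.flowHomeomorph hΨ s t).toEquiv.image_symm_eq_preimage S).symm
  have hm : MeasurableSet (Ψ t s '' S) :=
    (hF.flowHomeomorph hΨ t s).measurableEmbedding.measurableSet_image' hS
  have h2 : Ψ s t '' (Ψ t s '' S) = S := by
    simp [Set.image_image, hF.flow_flow_cancel hΨ]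
  rw [h1]
  refine le_antisymm (hF.volume_image_flow_le hΨ hdiv hU huU t s hS) ?_
  conv_lhs => rw [← h2]
  exact hF.volume_image_flow_le hΨ hdiv hU huU s t hm

theorem volume_inter_image_flow (hdiv : DivergenceFree u) {U : ℝ} (hU : 0 ≤ U)
    (huU : ∀ t x, ‖u t x‖ ≤ U) (s t : ℝ) (A L : Set Plane) :
    volume (A ∩ Ψ s t '' L) = volume (Ψ s t ⁻¹' A ∩ L) := by
  rw [← (hF.measurePreserving_flow hΨ hdiv hU huU s t).measure_preimage_equiv]
  change volume (Ψ s t ⁻¹' (A ∩ Ψ s t '' L)) = _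
  have hinj : Function.Injective (Ψ s t) := (hF.flowHomeomorph hΨ s t).injective
  rw [Set.preimage_inter, Set.preimage_image_eq _ hinj]

end BoundedC11

/-! ### Loops which are contractible off a point -/

section ContractibleOff

variable {T : Type*} [TopologicalSpace T]

/-- The map `γ` avoids `x` and is null-homotopic in the complement of `x`. -/
def ContractibleOff (γ : C(T, Plane)) (x : Plane) : Prop :=
  ∃ g : C(T, ({x}ᶜ : Set Plane)), (∀ a, (g a : Plane) = γ a) ∧ g.Nullhomotopic

theorem ContractibleOff.apply_ne {γ : C(T, Plane)} {x : Plane} (h : ContractibleOff γ x) (a : T) :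
    γ a ≠ x := by
  obtain ⟨g, hg, -⟩ := h
  rw [← hg a]
  exact (g a).2

theorem contractibleOff_const (p : Plane) {x : Plane} (h : p ≠ x) :
    ContractibleOff (ContinuousMap.const T p) x :=
  ⟨ContinuousMap.const T ⟨p, h⟩, fun _ => rfl, ContinuousMap.nullhomotopic_of_constant _⟩

theorem ContractibleOff.homeomorph_comp {γ : C(T, Plane)} {x : Plane} (h : ContractibleOff γ x)
    (e : Plane ≃ₜ Plane) : ContractibleOff ((e : C(Plane, Plane)).comp γ) (e x) := by
  obtain ⟨g, hg, hn⟩ := h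
  let E : C(({x}ᶜ : Set Plane), ({e x}ᶜ : Set Plane)) :=
    ⟨fun y => ⟨e y, fun hy => y.2 (e.injective hy)⟩,
      (e.continuous.comp continuous_subtype_val).subtype_mk _⟩
  exact ⟨E.comp g, fun a => congrArg e (hg a), hn.comp_right E⟩

theorem contractibleOff_homeomorph_comp_iff (γ : C(T, Plane)) (x : Plane) (e : Plane ≃ₜ Plane) :
    ContractibleOff ((e : C(Plane, Plane)).comp γ) (e x) ↔ ContractibleOff γ x := by
  refine ⟨fun h => ?_, fun h => h.homeomorph_comp e⟩
  have h' := h.homeomorph_comp e.symm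
  rw [e.symm_apply_apply] at h'
  convert h'
  ext a : 1
  simp

theorem ContractibleOff.of_lineMap_ne {γ γ' : C(T, Plane)} {x : Plane} (h : ContractibleOff γ x)
    (hne : ∀ a, ∀ θ ∈ Set.Icc (0 : ℝ) 1, AffineMap.lineMap (γ a) (γ' a) θ ≠ x) :
    ContractibleOff γ' x := by
  obtain ⟨g, hg, hn⟩ := h
  have h1 : ∀ a, γ' a ∈ ({x}ᶜ : Set Plane) := fun a => by
    simpa using hne a 1 ⟨zero_le_one, le_rfl⟩
  have h2 : ∀ z : unitInterval × T,
      AffineMap.lineMap (γ' z.2) (γ z.2) (z.1 : ℝ) ∈ ({x}ᶜ : Set Plane) := fun z => by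
    -- The straight-line homotopy runs from `γ'` back to `γ`, to be followed by the given
    -- contraction of `γ`.
    have := hne z.2 (1 - z.1) ⟨sub_nonneg.2 z.1.2.2, sub_le_self _ z.1.2.1⟩
    rwa [AffineMap.lineMap_apply_one_sub] at this
  let g' : C(T, ({x}ᶜ : Set Plane)) := ⟨fun a => ⟨γ' a, h1 a⟩, γ'.continuous.subtype_mk _⟩
  let H : g'.Homotopy g :=
    { toFun := fun z => ⟨AffineMap.lineMap (γ' z.2) (γ z.2) (z.1 : ℝ), h2 z⟩
      continuous_toFun := by
        refine Continuous.subtype_mk ?_ _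
        simp only [AffineMap.lineMap_apply_module]
        fun_prop
      map_zero_left := fun a => Subtype.ext (by simp [g'])
      map_one_left := fun a => Subtype.ext (by simp [hg]) }
  obtain ⟨y, hy⟩ := hn
  exact ⟨g', fun _ => rfl, y, ContinuousMap.Homotopic.trans ⟨H⟩ hy⟩

theorem lineMap_ne_of_norm_sub_lt {p q x : Plane} (h : ‖p - q‖ < dist p x) {θ : ℝ}
    (hθ : θ ∈ Set.Icc (0 : ℝ) 1) : AffineMap.lineMap p q θ ≠ x := by
  rintro rfl
  rw [dist_left_lineMap, Real.norm_eq_abs, abs_of_nonneg hθ.1, dist_eq_norm] at h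
  nlinarith [hθ.2, norm_nonneg (p - q)]

/-- This is the argument of Rouché's theorem: the segment from `γ a` to `γ' a` is too short to reach
`x`. -/
theorem contractibleOff_congr_of_norm_sub_lt {γ γ' : C(T, Plane)} {x : Plane}
    (h : ∀ a, ‖γ a - γ' a‖ < dist (γ a) x) : ContractibleOff γ x ↔ ContractibleOff γ' x := by
  refine ⟨fun hc => hc.of_lineMap_ne fun a θ hθ => lineMap_ne_of_norm_sub_lt (h a) hθ,
    fun hc => hc.of_lineMap_ne fun a θ hθ => ?_⟩
  rw [← AffineMap.lineMap_apply_one_sub]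
  exact lineMap_ne_of_norm_sub_lt (h a) ⟨sub_nonneg.2 hθ.2, sub_le_self _ hθ.1⟩

theorem contractibleOff_of_notMem_closedBall {γ : C(T, Plane)} {x p : Plane} {R : ℝ} (hR : 0 ≤ R)
    (h : ∀ a, γ a ∈ Metric.closedBall p R) (hx : x ∉ Metric.closedBall p R) :
    ContractibleOff γ x := by
  have hp : p ∈ Metric.closedBall p R := Metric.mem_closedBall_self hR
  have hpx : p ≠ x := by
    rintro rfl
    exact hx hp
  refine (contractibleOff_const (T := T) p hpx).of_lineMap_ne fun a θ hθ e => hx ?_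
  rw [← e]
  exact (convex_closedBall p R).lineMap_mem hp (h a) hθ

theorem contractibleOff_translate (γ : C(T, Plane)) (x w : Plane) :
    ContractibleOff (((Homeomorph.addRight w : Plane ≃ₜ Plane) : C(Plane, Plane)).comp γ) (x + w)
      ↔ ContractibleOff γ x :=
  contractibleOff_homeomorph_comp_iff γ x (Homeomorph.addRight w)

end ContractibleOff

/-! ### The polygonal curve -/

section Polygon

variable {n : ℕ} (v : ZMod n → Plane)

theorem polygonLoop_eq_of_mem_Icc (m : ℤ) {s : ℝ} (hs : s ∈ Set.Icc (m : ℝ) (m + 1)) :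
    polygonLoop v s = AffineMap.lineMap (v (m : ZMod n)) (v ((m : ZMod n) + 1)) (s - m) := by
  rcases hs.2.lt_or_eq with h | rfl
  · have : ⌊s⌋ = m := Int.floor_eq_iff.2 ⟨hs.1, h⟩
    rw [polygonLoop, Int.fract, this]
  · have h1 : ⌊(m : ℝ) + 1⌋ = m + 1 := by simp
    rw [polygonLoop, Int.fract, h1]
    simp

theorem continuous_polygonLoop : Continuous (polygonLoop v) := by
  refine continuous_iff_continuousAt.2 fun s => ?_
  set m := ⌊s⌋ with hm
  -- Gluing the pieces `m - 1` and `m` gives a formula valid on a full neighbourhood of `s`, even if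
  -- `s` is an integer.
  have hc : Continuous fun r : ℝ => if r ≤ (m : ℝ)
      then (AffineMap.lineMap (v ((m - 1 : ℤ) : ZMod n)) (v (((m - 1 : ℤ) : ZMod n) + 1))
        (r - (m - 1 : ℤ)) : Plane)
      else AffineMap.lineMap (v (m : ZMod n)) (v ((m : ZMod n) + 1)) (r - m) := by
    refine Continuous.if_le ?_ ?_ continuous_id continuous_const ?_
    · simp only [AffineMap.lineMap_apply_module]; fun_prop
    · simp only [AffineMap.lineMap_apply_module]; fun_prop
    · rintro r rfl
      simp
  refine hc.continuousAt.congr ?_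
  have h1 : (m : ℝ) - 1 < s := by linarith [Int.floor_le s]
  have h2 : s < m + 1 := Int.lt_floor_add_one s
  filter_upwards [Ioo_mem_nhds h1 h2] with r hr
  split_ifs with h
  · rw [polygonLoop_eq_of_mem_Icc v (m - 1)]
    push_cast
    exact ⟨hr.1.le, by linarith⟩
  · rw [polygonLoop_eq_of_mem_Icc v m ⟨(not_le.1 h).le, hr.2.le⟩]

theorem periodic_polygonLoop : Function.Periodic (polygonLoop v) (n : ℝ) := fun s => by
  simp [polygonLoop]

/-- The closed polygonal curve as a map on the circle. -/
def polygonCurve : C(AddCircle (n : ℝ), Plane) :=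
  ⟨(periodic_polygonLoop v).lift, continuous_coinduced_dom.2 (continuous_polygonLoop v)⟩

theorem polygonCurve_coe (s : ℝ) : polygonCurve v (s : AddCircle (n : ℝ)) = polygonLoop v s := rfl

theorem polygonContractibleOff_iff (x : Plane) :
    PolygonContractibleOff v x ↔ ContractibleOff (polygonCurve v) x :=
  exists_congr fun g => and_congr_left fun _ =>
    (QuotientAddGroup.mk_surjective.forall
      (p := fun a : AddCircle (n : ℝ) => (g a : Plane) = polygonCurve v a)).symm

theorem mem_polygonRegion_iff {x : Plane} :
    x ∈ polygonRegion v ↔ ¬ ContractibleOff (polygonCurve v) x :=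
  not_congr (polygonContractibleOff_iff v x)

theorem polygonCurve_mem_polygonRegion (a : AddCircle (n : ℝ)) :
    polygonCurve v a ∈ polygonRegion v :=
  (mem_polygonRegion_iff v).2 fun h => h.apply_ne a rfl

theorem corner_mem_polygonRegion [NeZero n] (i : ZMod n) : v i ∈ polygonRegion v := by
  have := polygonCurve_mem_polygonRegion v ((i.val : ℝ) : AddCircle (n : ℝ))
  rw [polygonCurve_coe, polygonLoop_eq_of_mem_Icc v (i.val : ℤ) (by simp)] at this
  simpa only [Int.cast_natCast, ZMod.natCast_zmod_val, sub_self, AffineMap.lineMap_apply_zero]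
    using this

/-- The edge and the parameter do not depend on `v`, so two polygons can be compared at the same
point of the circle. -/
theorem exists_polygonCurve_eq_lineMap (a : AddCircle (n : ℝ)) :
    ∃ k : ZMod n, ∃ θ ∈ Set.Icc (0 : ℝ) 1,
    ∀ v : ZMod n → Plane, polygonCurve v a = AffineMap.lineMap (v k) (v (k + 1)) θ := by
  obtain ⟨s, rfl⟩ := QuotientAddGroup.mk_surjective a
  exact ⟨_, _, ⟨Int.fract_nonneg s, (Int.fract_lt_one s).le⟩, fun v => rfl⟩

theorem polygonCurve_mem_of_convex {C : Set Plane} (hC : Convex ℝ C) (h : ∀ i, v i ∈ C)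
    (a : AddCircle (n : ℝ)) : polygonCurve v a ∈ C := by
  obtain ⟨k, θ, hθ, e⟩ := exists_polygonCurve_eq_lineMap a
  rw [e]
  exact hC.lineMap_mem (h _) (h _) hθ

theorem norm_polygonCurve_sub_le {v v' : ZMod n → Plane} {ε : ℝ} (h : ∀ i, ‖v i - v' i‖ ≤ ε)
    (a : AddCircle (n : ℝ)) : ‖polygonCurve v a - polygonCurve v' a‖ ≤ ε := by
  obtain ⟨k, θ, hθ, e⟩ := exists_polygonCurve_eq_lineMap a
  have := (convex_closedBall (0 : Plane) ε).lineMap_mem (x := v k - v' k)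
    (y := v (k + 1) - v' (k + 1)) (by simpa using h k) (by simpa using h (k + 1)) hθ
  rw [mem_closedBall_zero_iff] at this
  have h' : AffineMap.lineMap (v k) (v (k + 1)) θ - AffineMap.lineMap (v' k) (v' (k + 1)) θ
      = AffineMap.lineMap (v k - v' k) (v (k + 1) - v' (k + 1)) θ := by
    simp only [AffineMap.lineMap_apply_module]
    module
  rw [e, e, h']
  exact this

theorem isBounded_polygonRegion [NeZero n] : Bornology.IsBounded (polygonRegion v) := by
  obtain ⟨R, hR⟩ := (Set.finite_range v).isBounded.subset_closedBall (0 : Plane)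
  refine (Metric.isBounded_closedBall (x := (0 : Plane)) (r := max R 0)).subset fun x hx => ?_
  by_contra hn
  refine (mem_polygonRegion_iff v).1 hx (contractibleOff_of_notMem_closedBall (le_max_right _ _)
    (polygonCurve_mem_of_convex v (convex_closedBall _ _) fun i => ?_) hn)
  exact Metric.closedBall_subset_closedBall (le_max_left _ _) (hR ⟨i, rfl⟩)

theorem norm_corner_sub_le_diam [NeZero n] (i j : ZMod n) :
    ‖v i - v j‖ ≤ Metric.diam (polygonRegion v) := by
  rw [← dist_eq_norm]
  exact Metric.dist_le_diam_of_mem (isBounded_polygonRegion v) (corner_mem_polygonRegion v i)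
    (corner_mem_polygonRegion v j)

/-- The closed neighbourhood of width `ε` of the polygonal curve. -/
def polygonTube (ε : ℝ) : Set Plane :=
  {x | ∃ a, dist (polygonCurve v a) x ≤ ε}

/-- Off the tube, closeness of loops decides contractibility. -/
theorem symmDiff_polygonRegion_subset {γ : C(AddCircle (n : ℝ), Plane)} {ε : ℝ}
    (h : ∀ a, ‖polygonCurve v a - γ a‖ ≤ ε) :
    symmDiff (polygonRegion v) {x | ¬ ContractibleOff γ x} ⊆ polygonTube v ε := by
  intro x hx
  by_contra hn
  have hc := contractibleOff_congr_of_norm_sub_lt (γ := polygonCurve v) (γ' := γ) (x := x)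
    fun a => (h a).trans_lt (not_le.1 fun h' => hn ⟨a, h'⟩)
  rw [Set.mem_symmDiff, mem_polygonRegion_iff, Set.mem_ofPred_eq, hc] at hx
  tauto

/-- Off the curve, contractibility is locally constant in the point. -/
theorem polygonRegion_subset_interior_union_range [NeZero n] :
    polygonRegion v ⊆ interior (polygonRegion v) ∪ Set.range (polygonCurve v) := by
  intro x hx
  by_cases hr : x ∈ Set.range (polygonCurve v)
  · exact Or.inr hr
  left
  have hcl : IsClosed (Set.range (polygonCurve v)) := by
    have : Fact (0 < (n : ℝ)) := ⟨Nat.cast_pos.2 (NeZero.pos n)⟩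
    exact (isCompact_range (polygonCurve v).continuous).isClosed
  obtain ⟨η, hη, hball⟩ := Metric.mem_nhds_iff.1 (hcl.isOpen_compl.mem_nhds hr)
  rw [mem_interior_iff_mem_nhds]
  filter_upwards [Metric.ball_mem_nhds x hη] with y hy
  rw [mem_polygonRegion_iff] at hx ⊢
  refine fun hc => hx ?_
  -- Instead of moving the point from `y` to `x`, the loop is translated by `x - y`, which is less
  -- than its distance from `x`.
  rw [← contractibleOff_translate _ _ (x - y), add_sub_cancel] at hc
  refine (contractibleOff_congr_of_norm_sub_lt fun a => ?_).2 hc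
  have h1 : η ≤ dist (polygonCurve v a) x := not_lt.1 fun h' => hball h' ⟨a, rfl⟩
  have h2 : polygonCurve v a - (polygonCurve v a + (x - y)) = y - x := by abel
  change ‖polygonCurve v a - (polygonCurve v a + (x - y))‖ < _
  rw [h2, ← dist_eq_norm]
  exact (Metric.mem_ball.1 hy).trans_le h1

/-! ### Area of tubes around polygonal curves -/

theorem volume_segment_tube_le (a b : Plane) {ℓ ε : ℝ} (hε : 0 < ε) (hab : ‖a - b‖ ≤ ℓ) :
    volume {x : Plane | ∃ θ ∈ Set.Icc (0 : ℝ) 1, dist (AffineMap.lineMap a b θ) x ≤ ε}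
      ≤ ENNReal.ofReal (4 * Real.pi * (ε * (ℓ + 3 * ε))) := by
  have hℓ : 0 ≤ ℓ := (norm_nonneg _).trans hab
  -- Division points at spacing at most `ε` let `m + 1` balls of radius `2 * ε` cover the tube; the
  -- added `1` keeps `m` positive when `ℓ = 0`.
  set m : ℕ := ⌈ℓ / ε⌉₊ + 1 with hm
  have hm0 : (0 : ℝ) < m := by positivity
  have hm1 : ℓ ≤ ε * m := by
    have := Nat.le_ceil (ℓ / ε)
    rw [div_le_iff₀ hε] at this
    push_cast [hm]
    nlinarith
  have hsub : {x : Plane | ∃ θ ∈ Set.Icc (0 : ℝ) 1, dist (AffineMap.lineMap a b θ) x ≤ ε}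
      ⊆ ⋃ j ∈ Finset.range (m + 1),
        Metric.closedBall (AffineMap.lineMap a b ((j : ℝ) / m)) (2 * ε) := by
    rintro x ⟨θ, hθ, hx⟩
    have hθm : 0 ≤ θ * m := mul_nonneg hθ.1 hm0.le
    simp only [Set.mem_iUnion, Finset.mem_range, Metric.mem_closedBall]
    refine ⟨⌊θ * m⌋₊, ?_, ?_⟩
    · rw [Nat.lt_succ_iff]
      exact Nat.floor_le_of_le (mul_le_of_le_one_left hm0.le hθ.2)
    · have hd : dist (AffineMap.lineMap a b θ : Plane)
          (AffineMap.lineMap a b ((⌊θ * m⌋₊ : ℝ) / m)) ≤ ε := by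
        rw [dist_lineMap_lineMap, dist_eq_norm a b, Real.dist_eq]
        have h1 : |θ - (⌊θ * m⌋₊ : ℝ) / m| ≤ 1 / m := by
          have e : θ - (⌊θ * m⌋₊ : ℝ) / m = (θ * m - ⌊θ * m⌋₊) / m := by field_simp
          rw [e, abs_div, abs_of_pos hm0]
          gcongr
          rw [abs_le]
          constructor <;> linarith [Nat.floor_le hθm, Nat.lt_floor_add_one (θ * m)]
        calc _ ≤ 1 / m * ℓ := by gcongr
          _ ≤ 1 / m * (ε * m) := by gcongr
          _ = ε := by field_simp
      have := dist_triangle_left x (AffineMap.lineMap a b ((⌊θ * m⌋₊ : ℝ) / m))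
        (AffineMap.lineMap a b θ)
      linarith
  refine (measure_mono hsub).trans ((measure_biUnion_finset_le _ _).trans ?_)
  simp only [EuclideanSpace.volume_closedBall_fin_two, Finset.sum_const, Finset.card_range,
    nsmul_eq_mul]
  rw [← ENNReal.ofReal_pow (by positivity), ← ENNReal.ofReal_mul (by positivity),
    ← ENNReal.ofReal_natCast, ← ENNReal.ofReal_mul (by positivity)]
  refine ENNReal.ofReal_le_ofReal ?_
  have hm2 : (m : ℝ) * ε ≤ ℓ + 2 * ε := by
    have := Nat.ceil_lt_add_one (div_nonneg hℓ hε.le)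
    have h2 : ℓ / ε * ε = ℓ := by field_simp
    push_cast [hm]
    nlinarith
  have h3 := mul_le_mul_of_nonneg_left hm2 (by positivity : 0 ≤ 4 * Real.pi * ε)
  push_cast
  nlinarith

theorem volume_polygonTube_le [NeZero n] {ℓ ε : ℝ} (hε : 0 < ε)
    (hv : ∀ i, ‖v i - v (i + 1)‖ ≤ ℓ) :
    volume (polygonTube v ε) ≤ ENNReal.ofReal (n * (4 * Real.pi * (ε * (ℓ + 3 * ε)))) := by
  have hsub : polygonTube v ε ⊆ ⋃ k : ZMod n, {x : Plane | ∃ θ ∈ Set.Icc (0 : ℝ) 1,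
      dist (AffineMap.lineMap (v k) (v (k + 1)) θ) x ≤ ε} := by
    rintro x ⟨a, ha⟩
    obtain ⟨k, θ, hθ, e⟩ := exists_polygonCurve_eq_lineMap a
    exact Set.mem_iUnion.2 ⟨k, θ, hθ, by rwa [← e]⟩
  refine (measure_mono hsub).trans ((measure_iUnion_fintype_le _ _).trans ?_)
  refine (Finset.sum_le_sum fun k _ => volume_segment_tube_le _ _ hε (hv k)).trans (le_of_eq ?_)
  rw [Finset.sum_const, Finset.card_univ, ZMod.card, nsmul_eq_mul, ← ENNReal.ofReal_natCast,
    ← ENNReal.ofReal_mul (Nat.cast_nonneg n)]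

theorem M0_polygonTube_le [NeZero n] {ℓ ε : ℝ} (hε : 0 < ε) (hv : ∀ i, ‖v i - v (i + 1)‖ ≤ ℓ) :
    volume (polygonTube v ε) ≠ ⊤ ∧
      M0 (polygonTube v ε) ≤ n * (4 * Real.pi * (ε * (ℓ + 3 * ε))) := by
  have h := volume_polygonTube_le v hε hv
  have hℓ : 0 ≤ ℓ := (norm_nonneg _).trans (hv 0)
  refine ⟨ne_top_of_le_ne_top ENNReal.ofReal_ne_top h, ?_⟩
  exact ENNReal.toReal_le_of_le_ofReal (by positivity) h

/-- The curve lies in tubes of every width, whose areas tend to zero. -/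
theorem volume_range_polygonCurve [NeZero n] : volume (Set.range (polygonCurve v)) = 0 := by
  have hlim : Filter.Tendsto (fun ε : ℝ => ENNReal.ofReal
      (n * (4 * Real.pi * (ε * (Metric.diam (polygonRegion v) + 3 * ε)))))
      (nhdsWithin 0 (Set.Ioi 0)) (nhds 0) := by
    have hc : Continuous (fun ε : ℝ => ENNReal.ofReal
      (n * (4 * Real.pi * (ε * (Metric.diam (polygonRegion v) + 3 * ε))))) :=
      ENNReal.continuous_ofReal.comp (by fun_prop)
    have := hc.tendsto 0
    simp only [zero_mul, mul_zero, ENNReal.ofReal_zero] at this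
    exact this.mono_left nhdsWithin_le_nhds
  refine le_antisymm (ge_of_tendsto hlim ?_) zero_le
  filter_upwards [self_mem_nhdsWithin] with ε hε
  refine (measure_mono ?_).trans
    (volume_polygonTube_le v hε fun i => norm_corner_sub_le_diam v i (i + 1))
  rintro _ ⟨a, rfl⟩
  exact ⟨a, by simpa using (Set.mem_Ioi.1 hε).le⟩

theorem volume_polygonRegion_diff_interior [NeZero n] :
    volume (polygonRegion v \ interior (polygonRegion v)) = 0 :=
  measure_mono_null (fun _ hx =>
    (polygonRegion_subset_interior_union_range v hx.1).resolve_left hx.2)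
    (volume_range_polygonCurve v)

end Polygon

/-! ### Accuracy of the interpolation and of the time integration -/

theorem norm_le_of_forall_abs_le {z : Plane} {m : ℝ} (hz : ∀ k, |z k| ≤ m) : ‖z‖ ≤ 2 * m := by
  have hm : 0 ≤ m := (abs_nonneg _).trans (hz 0)
  rw [EuclideanSpace.norm_eq, Fin.sum_univ_two, Real.sqrt_le_iff]
  have h0 := pow_le_pow_left₀ (abs_nonneg _) (hz 0) 2
  have h1 := pow_le_pow_left₀ (abs_nonneg _) (hz 1) 2
  simp only [Real.norm_eq_abs]
  exact ⟨by positivity, by nlinarith⟩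

theorem StaggeredInterpolation.field_apply {ρ Λ h : ℝ} (I : StaggeredInterpolation ρ Λ h)
    (u : ℝ → Plane → Plane) (t θ : ℝ) {δ : ℝ} (hδ : δ ≠ 0) (x : Plane) (k : Fin 2) :
    I.field u t δ (t + θ * δ) x k = ∑ p ∈ I.stencil k x, I.weight k x p *
      ((1 - θ) * u t p k + θ * u (t + δ) p k) := by
  have h1 : (t + δ - (t + θ * δ)) / δ = 1 - θ := by field_simp; ring
  have h2 : (t + θ * δ - t) / δ = θ := by field_simp; ring
  simp only [StaggeredInterpolation.field, h1, h2]

/-- Products of the time weights `1 - θ`, `θ` and the space weights reproduce affine functions on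
space-time, so the error is of second order there. As Runge–Kutta stages may lie outside the time
step, `θ` is not confined to `[0, 1]`. -/
theorem StaggeredInterpolation.norm_field_sub_le {ρ Λ h : ℝ} (I : StaggeredInterpolation ρ Λ h)
    {u : ℝ → Plane → Plane} {B : ℝ} (hF : BoundedC11 (Function.uncurry u) B) (t : ℝ) {θ δ : ℝ}
    (hδ : 0 < δ) (x : Plane) :
    ‖I.field u t δ (t + θ * δ) x - u (t + θ * δ) x‖
      ≤ 2 * (Λ * (|1 - θ| + |θ|) * (B * ((|1 - θ| + |θ|) * δ + |ρ * h|) ^ 2)) := by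
  have hB := hF.nonneg
  refine norm_le_of_forall_abs_le fun k => ?_
  set m := (|1 - θ| + |θ|) * δ + |ρ * h| with hm
  have key := hF.norm_sum_smul_sub_le (I.stencil k x ×ˢ (Finset.univ : Finset (Fin 2)))
    (fun z => I.weight k x z.1 * ![1 - θ, θ] z.2) (fun z => (![t, t + δ] z.2, z.1))
    (t + θ * δ, x) ?_ ?_
  rotate_left
  · simp [Finset.sum_product, ← mul_add, I.sum_weight]
  · simp only [Finset.sum_product, Fin.sum_univ_two, Matrix.cons_val_zero, Matrix.cons_val_one,
      Prod.smul_mk, Prod.mk_add_mk, smul_eq_mul, ← add_smul, ← mul_add, sub_add_cancel, mul_one]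
    refine Prod.ext ?_ ?_
    · rw [Prod.fst_sum]
      have : ∀ p, I.weight k x p * (1 - θ) * t + I.weight k x p * θ * (t + δ)
          = I.weight k x p * (t + θ * δ) := fun p => by ring
      simp only [this, ← Finset.sum_mul, I.sum_weight, one_mul]
    · rw [Prod.snd_sum]
      exact I.sum_weight_smul k x
  have hdist : ∀ z ∈ I.stencil k x ×ˢ (Finset.univ : Finset (Fin 2)),
      ‖((![t, t + δ] z.2, z.1) : ℝ × Plane) - (t + θ * δ, x)‖ ≤ m := by
    rintro ⟨p, j⟩ hz
    have hp := I.stencil_near k x p (Finset.mem_product.1 hz).1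
    rw [dist_eq_norm] at hp
    rw [Prod.mk_sub_mk, Prod.norm_mk]
    have hθ : 0 ≤ |θ| * δ := by positivity
    have hθ' : 0 ≤ |1 - θ| * δ := by positivity
    refine max_le ?_ ?_
    · fin_cases j
      · have e : t - (t + θ * δ) = -(θ * δ) := by ring
        simp only [Fin.zero_eta, Matrix.cons_val_zero, e, Real.norm_eq_abs, abs_neg, abs_mul,
          abs_of_pos hδ]
        linarith [abs_nonneg (ρ * h)]
      · have e : t + δ - (t + θ * δ) = (1 - θ) * δ := by ring
        simp only [Fin.mk_one, Matrix.cons_val_one, Matrix.cons_val_fin_one, e,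
          Real.norm_eq_abs, abs_mul, abs_of_pos hδ]
        linarith [abs_nonneg (ρ * h)]
    · linarith [le_abs_self (ρ * h)]
  have hsum : ∑ z ∈ I.stencil k x ×ˢ (Finset.univ : Finset (Fin 2)),
      |I.weight k x z.1 * ![1 - θ, θ] z.2| ≤ Λ * (|1 - θ| + |θ|) := by
    simp only [Finset.sum_product, Fin.sum_univ_two, Matrix.cons_val_zero, Matrix.cons_val_one,
      abs_mul, ← mul_add, ← Finset.sum_mul]
    exact mul_le_mul_of_nonneg_right (I.sum_abs_weight k x) (by positivity)
  have hbound : ‖∑ z ∈ I.stencil k x ×ˢ (Finset.univ : Finset (Fin 2)),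
      (I.weight k x z.1 * ![1 - θ, θ] z.2) • Function.uncurry u (![t, t + δ] z.2, z.1)
        - Function.uncurry u (t + θ * δ, x)‖ ≤ Λ * (|1 - θ| + |θ|) * (B * m ^ 2) := by
    refine key.trans ?_
    calc _ ≤ ∑ z ∈ I.stencil k x ×ˢ (Finset.univ : Finset (Fin 2)),
        |I.weight k x z.1 * ![1 - θ, θ] z.2| * (B * m ^ 2) := by
          refine Finset.sum_le_sum fun z hz => mul_le_mul_of_nonneg_left ?_ (abs_nonneg _)
          exact mul_le_mul_of_nonneg_left (pow_le_pow_left₀ (norm_nonneg _) (hdist z hz) 2) hB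
      _ ≤ _ := by
          rw [← Finset.sum_mul]
          exact mul_le_mul_of_nonneg_right hsum (by positivity)
  refine le_trans (le_of_eq ?_) ((PiLp.norm_apply_le _ k).trans hbound)
  rw [Real.norm_eq_abs]
  congr 1
  rw [PiLp.sub_apply, PiLp.sub_apply, I.field_apply u t θ hδ.ne' x k]
  simp [Finset.sum_product, WithLp.ofLp_sum, Finset.sum_add_distrib, mul_add, mul_assoc]

namespace RungeKutta

variable {s : ℕ}

/-- A perturbation of the velocity field by `η` changes a short step of length `δ` by `O(δ η)`. -/
theorem IsStep.exists_isStep_near {R : RungeKutta s} {v u : ℝ → Plane → Plane} {t δ η B : ℝ}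
    {x y : Plane} (h : R.IsStep v t δ x y) (hB : 0 ≤ B)
    (hu : ∀ t x y, ‖u t x - u t y‖ ≤ B * ‖x - y‖)
    (hδ : |δ| * (B * ∑ i, ∑ j, |R.A i j|) ≤ 1 / 2) (hη : 0 ≤ η)
    (hv : ∀ i z, ‖v (t + R.c i * δ) z - u (t + R.c i * δ) z‖ ≤ η) :
    ∃ y', R.IsStep u t δ x y' ∧ ‖y - y'‖ ≤ |δ| * (∑ i, |R.b i|) * (2 * η) := by
  obtain ⟨k, hk, rfl⟩ := h
  -- The stages of a step for `u` are the fixed points of `f`. For a short step `f` is a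
  -- contraction, so such a step exists even for an implicit method.
  let f : (Fin s → Plane) → Fin s → Plane :=
    fun l i => u (t + R.c i * δ) (x + δ • ∑ j, R.A i j • l j)
  have hf : ContractingWith (1 / 2 : NNReal) f := by
    refine ⟨by norm_num, LipschitzWith.of_dist_le_mul fun l l' => ?_⟩
    refine (dist_pi_le_iff (by positivity)).2 fun i => ?_
    rw [dist_eq_norm]
    refine (hu _ _ _).trans ?_
    rw [add_sub_add_left_eq_sub, ← smul_sub, norm_smul, Real.norm_eq_abs, ← Finset.sum_sub_distrib]
    have h1 : ‖∑ j, (R.A i j • l j - R.A i j • l' j)‖ ≤ (∑ i, ∑ j, |R.A i j|) * dist l l' := by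
      refine (norm_sum_le _ _).trans ?_
      calc _ ≤ ∑ j, |R.A i j| * dist l l' := Finset.sum_le_sum fun j _ => by
            rw [← smul_sub, norm_smul, Real.norm_eq_abs, ← dist_eq_norm]
            exact mul_le_mul_of_nonneg_left (dist_le_pi_dist l l' j) (abs_nonneg _)
        _ = (∑ j, |R.A i j|) * dist l l' := by rw [Finset.sum_mul]
        _ ≤ _ := by
          refine mul_le_mul_of_nonneg_right ?_ dist_nonneg
          exact Finset.single_le_sum (f := fun i => ∑ j, |R.A i j|)
            (fun i _ => Finset.sum_nonneg fun j _ => abs_nonneg _) (Finset.mem_univ i)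
    calc _ ≤ B * (|δ| * ((∑ i, ∑ j, |R.A i j|) * dist l l')) := by gcongr
      _ = |δ| * (B * ∑ i, ∑ j, |R.A i j|) * dist l l' := by ring
      _ ≤ 1 / 2 * dist l l' := by gcongr
      _ = _ := by norm_num
  set l := ContractingWith.fixedPoint f hf with hl
  have hfix : f l = l := hf.fixedPoint_isFixedPt
  -- The stages for `v` are fixed by `f` up to `η`, which the contraction factor `1 / 2` turns into
  -- `2 * η`.
  have hkl : dist k l ≤ 2 * η := by
    have h1 := hf.dist_fixedPoint_le k
    have h2 : dist k (f k) ≤ η := by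
      refine (dist_pi_le_iff hη).2 fun i => ?_
      rw [dist_eq_norm]
      nth_rewrite 1 [hk i]
      exact hv i _
    refine h1.trans ?_
    rw [div_le_iff₀ (by norm_num)]
    norm_num
    linarith
  refine ⟨_, ⟨l, fun i => (congrFun hfix i).symm, rfl⟩, ?_⟩
  rw [add_sub_add_left_eq_sub, ← smul_sub, norm_smul, Real.norm_eq_abs, ← Finset.sum_sub_distrib,
    mul_assoc]
  refine mul_le_mul_of_nonneg_left ((norm_sum_le _ _).trans ?_) (abs_nonneg _)
  rw [Finset.sum_mul]
  refine Finset.sum_le_sum fun i _ => ?_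
  rw [← smul_sub, norm_smul, Real.norm_eq_abs, ← dist_eq_norm]
  exact mul_le_mul_of_nonneg_left ((dist_le_pi_dist k l i).trans hkl) (abs_nonneg _)

/-- The error of one backward step with the interpolated velocity field. -/
theorem HasOrder.exists_backtrace_error_le {R : RungeKutta s} {q : ℕ} (hR : R.HasOrder q)
    {u : ℝ → Plane → Plane} (hu : SmoothBounded u) {Ψ : ℝ → ℝ → Plane → Plane}
    (hΨ : IsFlowMap u Ψ) {a : ℝ} (ha : 0 < a) (ρ Λ : ℝ) :
    ∃ C h₀ : ℝ, 0 ≤ C ∧ 0 < h₀ ∧ ∀ h, 0 < h → h ≤ h₀ → ∀ (t δ : ℝ), 0 < δ → δ ≤ a * h →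
      ∀ (I : StaggeredInterpolation ρ Λ h) (x y : Plane),
        R.IsStep (I.field u t δ) (t + δ) (-δ) x y →
        ‖y - Ψ (t + δ) t x‖ ≤ C * (h ^ 3 + h ^ (q + 1)) := by
  obtain ⟨B, hF⟩ := hu.exists_boundedC11
  have hB := hF.nonneg
  obtain ⟨C₀, δ₀, hδ₀, hord⟩ := hR u hu
  set A := B * ∑ i, ∑ j, |R.A i j| with hA
  have hA0 : 0 ≤ A := by positivity
  set T := 1 + 2 * ∑ i, |R.c i| with hT
  have hT0 : 0 ≤ T := by positivity
  set b := ∑ i, |R.b i| with hb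
  have hb0 : 0 ≤ b := by positivity
  set η := 2 * (|Λ| * T * (B * (T * a + |ρ|) ^ 2)) with hη
  have hη0 : 0 ≤ η := by positivity
  -- The first bound on `h` ensures `δ ≤ δ₀`, the second the contraction condition `δ * A ≤ 1 / 2`;
  -- `A + 1` avoids division by zero.
  refine ⟨a * b * (2 * η) + |C₀| * a ^ (q + 1), min (δ₀ / a) (1 / (2 * (A + 1) * a)),
    by positivity, by positivity, ?_⟩
  intro h hh hh0 t δ hδ hδh I x y hstep
  have hδ1 : δ ≤ δ₀ := by
    have := hh0.trans (min_le_left _ _)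
    rw [le_div_iff₀ ha] at this
    linarith
  have hδ2 : δ * A ≤ 1 / 2 := by
    have := hh0.trans (min_le_right _ _)
    rw [le_div_iff₀ (by positivity)] at this
    have h2 : δ * A ≤ a * h * (A + 1) := mul_le_mul hδh (by linarith) hA0 (by positivity)
    linarith
  have hstage : ∀ i z, ‖I.field u t δ (t + δ + R.c i * -δ) z - u (t + δ + R.c i * -δ) z‖
      ≤ η * h ^ 2 := by
    intro i z
    have e : t + δ + R.c i * -δ = t + (1 - R.c i) * δ := by ring
    have hTi : |1 - (1 - R.c i)| + |1 - R.c i| ≤ T := by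
      have h1 : |R.c i| ≤ ∑ i, |R.c i| :=
        Finset.single_le_sum (f := fun i => |R.c i|) (fun i _ => abs_nonneg _) (Finset.mem_univ i)
      have h2 := abs_sub (1 : ℝ) (R.c i)
      rw [abs_one] at h2
      rw [sub_sub_cancel]
      linarith
    rw [e]
    refine (I.norm_field_sub_le hF t hδ z).trans ?_
    have hρ : |ρ * h| = |ρ| * h := by rw [abs_mul, abs_of_pos hh]
    rw [hρ]
    calc _ ≤ 2 * (|Λ| * T * (B * (T * (a * h) + |ρ| * h) ^ 2)) := by
          gcongr
          exact le_abs_self Λ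
      _ = η * h ^ 2 := by rw [hη]; ring
  obtain ⟨y', hy', hyy'⟩ := hstep.exists_isStep_near hB hF.velocity_lipschitz
    (by rwa [abs_neg, abs_of_pos hδ]) (by positivity) hstage
  have hx : Ψ (t + δ) (t + δ) x = x := (hΨ (t + δ) x).1
  have herr := hord (t + δ) (-δ) y' (fun τ => Ψ (t + δ) τ x)
    (by rwa [abs_neg, abs_of_pos hδ]) (hΨ (t + δ) x).2 (by simpa only [hx] using hy')
  simp only [add_neg_cancel_right] at herr
  rw [abs_neg, abs_of_pos hδ] at hyy' herr
  have h1 : δ * b * (2 * (η * h ^ 2)) ≤ a * b * (2 * η) * h ^ 3 := by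
    calc _ ≤ a * h * b * (2 * (η * h ^ 2)) := by gcongr
      _ = _ := by ring
  have h2 : C₀ * δ ^ (q + 1) ≤ |C₀| * a ^ (q + 1) * h ^ (q + 1) := by
    calc _ ≤ |C₀| * (a * h) ^ (q + 1) := by
          gcongr
          exact le_abs_self C₀
      _ = _ := by rw [mul_pow]; ring
  have h3 := norm_sub_le_norm_sub_add_norm_sub y y' (Ψ (t + δ) t x)
  have h4 : 0 ≤ a * b * (2 * η) * h ^ (q + 1) := by positivity
  have h5 : 0 ≤ |C₀| * a ^ (q + 1) * h ^ 3 := by positivity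
  nlinarith

end RungeKutta

/-! ### Comparison of areas -/

theorem abs_M0_sub_le {A B S : Set Plane} (hA : volume A ≠ ⊤) (hS : volume S ≠ ⊤)
    (hAB : A ⊆ B ∪ S) (hBA : B ⊆ A ∪ S) : |M0 A - M0 B| ≤ M0 S := by
  have hAS : volume (A ∪ S) ≠ ⊤ := measure_union_ne_top hA hS
  have hB : volume B ≠ ⊤ := measure_ne_top_of_subset hBA hAS
  have h1 : M0 A ≤ M0 B + M0 S :=
    (measureReal_mono hAB (measure_union_ne_top hB hS)).trans (measureReal_union_le _ _)
  have h2 : M0 B ≤ M0 A + M0 S := (measureReal_mono hBA hAS).trans (measureReal_union_le _ _)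
  rw [abs_le]
  constructor <;> linarith

/-- Changing both sets in an intersection, up to a null set. -/
theorem abs_M0_inter_sub_le {P P' P'' L L' L'' : Set Plane} (hL : volume L ≠ ⊤)
    (h1 : volume (symmDiff L L') ≠ ⊤) (h2 : volume (symmDiff P' P'') ≠ ⊤)
    (h3 : volume (symmDiff P P') ≠ ⊤) (hsub : L' ⊆ L'') (hnull : volume ((P'' ∩ L'') \ L') = 0) :
    |M0 (P ∩ L) - M0 (P'' ∩ L'')|
      ≤ M0 (symmDiff L L') + M0 (symmDiff P' P'') + M0 (symmDiff P P') := by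
  have hn : volume ((P'' ∩ L'') \ L') ≠ ⊤ := by simp [hnull]
  have hn' : M0 ((P'' ∩ L'') \ L') = 0 := by simp [M0, Measure.real, hnull]
  refine (abs_M0_sub_le (S := symmDiff L L' ∪ symmDiff P' P'' ∪ symmDiff P P' ∪ (P'' ∩ L'') \ L')
    (measure_ne_top_of_subset Set.inter_subset_right hL)
    (measure_union_ne_top (measure_union_ne_top (measure_union_ne_top h1 h2) h3) hn) ?_ ?_).trans ?_
  · rintro x ⟨hP, hL⟩
    have := @hsub x
    simp only [Set.mem_union, Set.mem_inter_iff, Set.mem_symmDiff, Set.mem_sdiff]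
    tauto
  · rintro x ⟨hP, hL⟩
    simp only [Set.mem_union, Set.mem_inter_iff, Set.mem_symmDiff, Set.mem_sdiff]
    tauto
  · have e1 := measureReal_union_le (μ := (volume : Measure Plane))
      (symmDiff L L' ∪ symmDiff P' P'' ∪ symmDiff P P') ((P'' ∩ L'') \ L')
    have e2 := measureReal_union_le (μ := (volume : Measure Plane))
      (symmDiff L L' ∪ symmDiff P' P'') (symmDiff P P')
    have e3 := measureReal_union_le (μ := (volume : Measure Plane))
      (symmDiff L L') (symmDiff P' P'')
    simp only [M0] at hn' ⊢
    linarith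

theorem M0_symmDiff_polygonRegion_le {n : ℕ} [NeZero n] (v : ZMod n → Plane)
    {γ : C(AddCircle (n : ℝ), Plane)} {ℓ ε : ℝ} (hε : 0 < ε) (hv : ∀ i, ‖v i - v (i + 1)‖ ≤ ℓ)
    (h : ∀ a, ‖polygonCurve v a - γ a‖ ≤ ε) :
    volume (symmDiff (polygonRegion v) {x | ¬ ContractibleOff γ x}) ≠ ⊤ ∧
      M0 (symmDiff (polygonRegion v) {x | ¬ ContractibleOff γ x})
        ≤ n * (4 * Real.pi * (ε * (ℓ + 3 * ε))) := by
  have hsub := symmDiff_polygonRegion_subset v h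
  obtain ⟨h1, h2⟩ := M0_polygonTube_le v hε hv
  exact ⟨measure_ne_top_of_subset hsub h1, (measureReal_mono hsub h1).trans h2⟩

/-! ### The CFL condition and the neighbours of a control volume -/

namespace PolygonalMesh

variable {Ω : Set Plane} (M : PolygonalMesh Ω)

instance (c : Fin M.numCells) : NeZero (M.numCorners c) :=
  ⟨by have := M.three_le c; omega⟩

theorem norm_corner_sub_le_size (c : Fin M.numCells) (i j : ZMod (M.numCorners c)) :
    ‖M.corner c i - M.corner c j‖ ≤ M.size :=
  (norm_corner_sub_le_diam (M.corner c) i j).trans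
    (le_ciSup (f := fun c => Metric.diam (M.cell c)) (Set.finite_range _).bddAbove c)

theorem nonempty_of_size_pos (h : 0 < M.size) : Nonempty (Fin M.numCells) := by
  by_contra hn
  rw [not_nonempty_iff] at hn
  rw [size, Real.iSup_of_isEmpty] at h
  exact h.false

include M in
theorem isBounded_domain : Bornology.IsBounded Ω := by
  rw [← M.cover]
  exact (Bornology.isBounded_iUnion).2 fun c => isBounded_polygonRegion (M.corner c)

/-- Under the CFL condition, liquid flows into a control volume only from its neighbours, up to
a null set. -/
theorem volume_preimage_inter_diff_neighbourhood {N : ℕ} {κ σ : ℝ} (hM : M.IsRegular N κ σ)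
    (hpos : 0 < σ * M.size) (φ : Plane → Plane) (hφ : ∀ x, dist (φ x) x ≤ σ * M.size)
    {L : Set Plane} (hL : L ⊆ Ω) (c : Fin M.numCells) :
    volume ((φ ⁻¹' M.cell c ∩ L) \ (L ∩ M.neighbourhood c)) = 0 := by
  -- Only boundary points of cells can be exceptional. They cannot be excluded outright, since
  -- displacement and separation may both equal `σ h`.
  refine measure_mono_null (t := ⋃ c', M.cell c' \ interior (M.cell c')) ?_
    (measure_iUnion_null fun c' => volume_polygonRegion_diff_interior (M.corner c'))
  rintro x ⟨⟨hx, hxL⟩, hxn⟩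
  obtain ⟨c', hc'⟩ := Set.mem_iUnion.1 (M.cover.symm ▸ hL hxL : x ∈ ⋃ c, polygonRegion (M.corner c))
  refine Set.mem_iUnion.2 ⟨c', hc', fun hint => ?_⟩
  have hneigh : ¬ M.Neighbours c c' := fun h => hxn ⟨hxL, Set.mem_biUnion h hc'⟩
  have hcont : Filter.Tendsto (fun θ : ℝ => (AffineMap.lineMap x (φ x) θ : Plane))
      (nhdsWithin 0 (Set.Ioi 0)) (nhds x) := by
    have : Continuous fun θ : ℝ => (AffineMap.lineMap x (φ x) θ : Plane) := by
      simp only [AffineMap.lineMap_apply_module]; fun_prop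
    have := this.tendsto 0
    simp only [AffineMap.lineMap_apply_zero] at this
    exact this.mono_left nhdsWithin_le_nhds
  -- An interior point can be moved slightly towards `φ x` inside its cell, which makes the distance
  -- to `φ x` strictly less than `σ h`.
  obtain ⟨θ, hθ, hθ1⟩ := ((hcont.eventually (isOpen_interior.mem_nhds hint)).and
    (Ioo_mem_nhdsGT one_pos)).exists
  have h1 := hM.separated c c' hneigh (φ x) hx _ (interior_subset hθ)
  rw [dist_right_lineMap, Real.norm_eq_abs, abs_of_pos (sub_pos.2 hθ1.2), dist_comm] at h1
  have h2 := hφ x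
  have h3 : (1 - θ) * dist (φ x) x ≤ (1 - θ) * (σ * M.size) :=
    mul_le_mul_of_nonneg_left h2 (sub_pos.2 hθ1.2).le
  nlinarith [mul_pos hθ1.1 hpos]

end PolygonalMesh

/-! ### The three errors -/

namespace BoundedC11

variable {u : ℝ → Plane → Plane} {B : ℝ} (hF : BoundedC11 (Function.uncurry u) B)
  {Ψ : ℝ → ℝ → Plane → Plane} (hΨ : IsFlowMap u Ψ) {Ω : Set Plane} (M : PolygonalMesh Ω)
include hF hΨ

theorem norm_flow_corner_sub_le {t δ : ℝ} (hδ : 0 < δ) (hδ1 : δ ≤ 1) (c : Fin M.numCells)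
    (i j : ZMod (M.numCorners c)) :
    ‖Ψ (t + δ) t (M.corner c i) - Ψ (t + δ) t (M.corner c j)‖ ≤ Real.exp B * M.size := by
  have h1 := M.norm_corner_sub_le_size c i j
  have h2 : |t - (t + δ)| ≤ 1 := by rwa [sub_add_cancel_left, abs_neg, abs_of_pos hδ]
  have h3 := hF.flow_lipschitz hΨ (t + δ) t (M.corner c i) (M.corner c j)
  have h4 : Real.exp (B * |t - (t + δ)|) ≤ Real.exp B :=
    Real.exp_le_exp.2 (mul_le_of_le_one_right hF.nonneg h2)
  have h0 := (norm_nonneg _).trans h1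
  rw [mul_comm]
  exact h3.trans (mul_le_mul h1 h4 (Real.exp_pos _).le h0)

/-- Contractibility off a point is invariant under homeomorphisms, so the preimage is described by a
loop and can be compared with polygons. -/
theorem preimage_eq (t δ : ℝ) (c : Fin M.numCells) :
    M.preimage Ψ t δ c = {x | ¬ ContractibleOff
      ((hF.flowHomeomorph hΨ (t + δ) t : C(Plane, Plane)).comp (polygonCurve (M.corner c))) x} := by
  ext x
  have h := contractibleOff_homeomorph_comp_iff (polygonCurve (M.corner c)) (Ψ t (t + δ) x)
    (hF.flowHomeomorph hΨ (t + δ) t)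
  have e : hF.flowHomeomorph hΨ (t + δ) t (Ψ t (t + δ) x) = x :=
    hF.flow_flow_cancel hΨ t (t + δ) x
  rw [e] at h
  exact (mem_polygonRegion_iff _).trans (not_congr h.symm)

/-- The tube has width `O(h ^ 3)` from `flow_lineMap` with `δ ≤ a h`; the `+ 1` keeps the width
positive when `B = 0`. -/
theorem errorRep_le {a t δ : ℝ} (hδ : 0 < δ) (hδ1 : δ ≤ 1) (ha : δ ≤ a * M.size)
    (hM : 0 < M.size) (c : Fin M.numCells) :
    volume (symmDiff (M.preimageRep Ψ t δ c) (M.preimage Ψ t δ c)) ≠ ⊤ ∧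
      M.errorRep Ψ t δ c ≤ M.numCorners c * (4 * Real.pi *
        (((B * Real.exp B ^ 3 * a + 1) * M.size ^ 3) *
          (Real.exp B * M.size + 3 * ((B * Real.exp B ^ 3 * a + 1) * M.size ^ 3)))) := by
  have hB := hF.nonneg
  have ha0 : 0 < a := pos_of_mul_pos_left (hδ.trans_le ha) hM.le
  unfold PolygonalMesh.errorRep PolygonalMesh.preimageRep
  rw [hF.preimage_eq hΨ]
  refine M0_symmDiff_polygonRegion_le _ (by positivity)
    (fun i => hF.norm_flow_corner_sub_le hΨ M hδ hδ1 c i (i + 1)) fun z => ?_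
  obtain ⟨k, θ, hθ, e⟩ := exists_polygonCurve_eq_lineMap z
  have h2 : |t - (t + δ)| = δ := by rw [sub_add_cancel_left, abs_neg, abs_of_pos hδ]
  have h := hF.flow_lineMap hΨ (t + δ) t (h2.trans_le hδ1) (M.corner c k) (M.corner c (k + 1)) hθ
  rw [norm_sub_rev, ← e (M.corner c), h2] at h
  rw [e]
  refine h.trans ?_
  have h1 := M.norm_corner_sub_le_size c k (k + 1)
  calc _ ≤ B * Real.exp B ^ 3 * M.size ^ 2 * (a * M.size) := by gcongr
    _ ≤ (B * Real.exp B ^ 3 * a + 1) * M.size ^ 3 := by nlinarith [pow_pos hM 3]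

theorem errorInt_le {t δ ε : ℝ} (hδ : 0 < δ) (hδ1 : δ ≤ 1) (hε : 0 < ε)
    {p : (c : Fin M.numCells) → ZMod (M.numCorners c) → Plane} (c : Fin M.numCells)
    (hp : ∀ i, ‖p c i - Ψ (t + δ) t (M.corner c i)‖ ≤ ε) :
    volume (symmDiff (M.preimageApprox p c) (M.preimageRep Ψ t δ c)) ≠ ⊤ ∧
      M.errorInt Ψ t δ p c ≤ M.numCorners c * (4 * Real.pi *
        (ε * (Real.exp B * M.size + 3 * ε))) := by
  have e : M.preimageApprox p c = {x | ¬ ContractibleOff (polygonCurve (p c)) x} :=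
    Set.ext fun x => mem_polygonRegion_iff _
  -- The tube is taken around the polygon with exact corners, whose edge lengths the flow controls.
  rw [PolygonalMesh.errorInt, symmDiff_comm, e]
  refine M0_symmDiff_polygonRegion_le _ hε
    (fun i => hF.norm_flow_corner_sub_le hΨ M hδ hδ1 c i (i + 1))
    (norm_polygonCurve_sub_le fun i => ?_)
  rw [norm_sub_rev]
  exact hp i

end BoundedC11

theorem PolygonalMesh.abs_volumeFraction_sub_le {u : ℝ → Plane → Plane} {B U : ℝ}
    (hF : BoundedC11 (Function.uncurry u) B) (hdiv : DivergenceFree u) (hU : 0 < U)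
    (huU : ∀ t x, ‖u t x‖ ≤ U) {Ψ : ℝ → ℝ → Plane → Plane} (hΨ : IsFlowMap u Ψ) {Ω : Set Plane}
    (M : PolygonalMesh Ω) {N : ℕ} {κ σ : ℝ} (hM : M.IsRegular N κ σ) (hpos : 0 < σ * M.size)
    {t δ : ℝ} (hδ : 0 < δ) (hδU : δ ≤ σ * M.size / U)
    {p : (c : Fin M.numCells) → ZMod (M.numCorners c) → Plane} {L : Set Plane}
    {Lapprox : Fin M.numCells → Set Plane} (hL : L ⊆ Ω) (c : Fin M.numCells)
    (hLa : volume (Lapprox c) ≠ ⊤)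
    (hrep : volume (symmDiff (M.preimageRep Ψ t δ c) (M.preimage Ψ t δ c)) ≠ ⊤)
    (hint : volume (symmDiff (M.preimageApprox p c) (M.preimageRep Ψ t δ c)) ≠ ⊤) :
    |M.volumeFractionApprox p Lapprox c - M.volumeFraction Ψ t δ L c|
      ≤ M.errorRec L Lapprox c / M0 (M.cell c) + M.errorRep Ψ t δ c / M0 (M.cell c)
        + M.errorInt Ψ t δ p c / M0 (M.cell c) := by
  have h0 : 0 ≤ M0 (M.cell c) := ENNReal.toReal_nonneg
  have hvol : M0 (M.cell c ∩ Ψ t (t + δ) '' L) = M0 (M.preimage Ψ t δ c ∩ L) :=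
    congrArg ENNReal.toReal (hF.volume_inter_image_flow hΨ hdiv hU.le huU t (t + δ) _ _)
  rw [PolygonalMesh.volumeFractionApprox, PolygonalMesh.volumeFraction, hvol, ← sub_div,
    ← add_div, ← add_div, abs_div, abs_of_nonneg h0]
  refine div_le_div_of_nonneg_right (abs_M0_inter_sub_le hLa ?_ hrep hint Set.inter_subset_left
    (M.volume_preimage_inter_diff_neighbourhood hM hpos (Ψ t (t + δ)) (fun x => ?_) hL c)) h0
  · have hLfin : volume L ≠ ⊤ := (M.isBounded_domain.subset hL).measure_lt_top.ne
    refine measure_ne_top_of_subset (fun x hx => ?_) (measure_union_ne_top hLa hLfin)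
    rcases hx with hx | hx
    · exact Or.inl hx.1
    · exact Or.inr hx.1.1
  · rw [dist_eq_norm]
    refine (hΨ.norm_sub_le hU.le huU t (t + δ) x).trans ?_
    rw [add_sub_cancel_left, abs_of_pos hδ, mul_comm]
    exact (le_div_iff₀ hU).1 hδU

end

/-! ### Choice of the constants -/

theorem theorem1
    -- the domain, the velocity field with its flow map, and the bound on the speed
    (Ω : Set Plane) (u : ℝ → Plane → Plane) (Ψ : ℝ → ℝ → Plane → Plane) (U : ℝ)
    (hu : SmoothBounded u) (hdiv : DivergenceFree u) (hΨ : IsFlowMap u Ψ)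
    (hU : 0 < U) (huU : ∀ t x, ‖u t x‖ ≤ U)
    -- the time integrator and its order
    {s : ℕ} (R : RungeKutta s) (q : ℕ) (hR : R.HasOrder q)
    -- the order and constant of the reconstruction; regularity of meshes and interpolation
    (r K : ℝ) (N : ℕ) (κ σ ρ Λ : ℝ) (hκ : 0 < κ) (hσ : 0 < σ) :
    ∃ C₁ C₂ C₃ h₀ : ℝ, 0 < h₀ ∧
      ∀ (M : PolygonalMesh Ω), M.IsRegular N κ σ → M.size ≤ h₀ →
      ∀ (t δ : ℝ), 0 < δ → δ ≤ σ * M.size / U →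
      ∀ (I : StaggeredInterpolation ρ Λ M.size)
        (p : (c : Fin M.numCells) → ZMod (M.numCorners c) → Plane),
        M.IsBacktraced R I u t δ p →
      ∀ (L : Set Plane) (Lapprox : Fin M.numCells → Set Plane),
        MeasurableSet L → L ⊆ Ω →
        (∀ c, MeasurableSet (Lapprox c)) → (∀ c, volume (Lapprox c) ≠ ⊤) →
        (∀ c, M.errorRec L Lapprox c ≤ K * M.size ^ r) →
      -- the error bound
      ‖M.volumeFractionApprox p Lapprox - M.volumeFraction Ψ t δ L‖
          ≤ C₁ * M.size ^ (r - 2) + C₂ * M.size ^ 2 + C₃ * (M.size ^ 2 + M.size ^ q) ∧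
      -- the origin of its three terms
      ∀ c, |M.volumeFractionApprox p Lapprox c - M.volumeFraction Ψ t δ L c|
            ≤ M.errorRec L Lapprox c / M0 (M.cell c) + M.errorRep Ψ t δ c / M0 (M.cell c)
              + M.errorInt Ψ t δ p c / M0 (M.cell c) ∧
          M.errorRec L Lapprox c / M0 (M.cell c) ≤ C₁ * M.size ^ (r - 2) ∧
          M.errorRep Ψ t δ c / M0 (M.cell c) ≤ C₂ * M.size ^ 2 ∧
          M.errorInt Ψ t δ p c / M0 (M.cell c) ≤ C₃ * (M.size ^ 2 + M.size ^ q) := by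
  obtain ⟨B, hF⟩ := hu.exists_boundedC11
  have hB := hF.nonneg
  have ha : 0 < σ / U := div_pos hσ hU
  obtain ⟨C, h₁, hC, hh₁, hback⟩ := hR.exists_backtrace_error_le hu hΨ ha ρ Λ
  set E := B * Real.exp B ^ 3 * (σ / U) + 1 with hE
  have hE0 : 0 < E := by positivity
  -- Each constant is an error bound divided by `κ h ^ 2`. The condition `h ≤ U / σ` gives `δ ≤ 1`,
  -- `h ≤ 1` absorbs higher powers of `h`, and `h₁` serves the time integration.
  refine ⟨K / κ, N * (4 * Real.pi * (E * (Real.exp B + 3 * E))) / κ,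
    N * (4 * Real.pi * ((C + 1) * (Real.exp B + 6 * (C + 1)))) / κ, min (min 1 (U / σ)) h₁,
    by positivity, ?_⟩
  intro M hM hsize
  set h := M.size with hh
  intro t δ hδ hδU I p hp L Lapprox _ hLΩ _ hLfin hrec
  -- A degenerate mesh is excluded by `0 < δ ≤ σ h / U`.
  have hpos : 0 < M.size := by
    by_contra hn
    have : σ * M.size / U ≤ 0 :=
      div_nonpos_of_nonpos_of_nonneg (mul_nonpos_of_nonneg_of_nonpos hσ.le (not_lt.1 hn)) hU.le
    linarith
  have hh1 : h ≤ 1 := hsize.trans ((min_le_left _ _).trans (min_le_left _ _))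
  have hhU : h ≤ U / σ := hsize.trans ((min_le_left _ _).trans (min_le_right _ _))
  have hδh : δ ≤ σ / U * h := by rwa [div_mul_eq_mul_div]
  have hδ1 : δ ≤ 1 := hδh.trans (by
    calc σ / U * h ≤ σ / U * (U / σ) := by gcongr
      _ = 1 := by field_simp)
  have hcell : ∀ c, κ * h ^ 2 ≤ M0 (M.cell c) := hM.area_ge
  have hκh : 0 < κ * h ^ 2 := by positivity
  have hdiv_le : ∀ c {e b : ℝ}, 0 ≤ e → e ≤ b → e / M0 (M.cell c) ≤ b / (κ * h ^ 2) :=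
    fun c e b he heb => div_le_div₀ (he.trans heb) heb hκh (hcell c)
  have hq : h ^ (q + 1) ≤ h := pow_le_of_le_one hpos.le hh1 (Nat.succ_ne_zero q)
  have h3 : h ^ 3 ≤ h := pow_le_of_le_one hpos.le hh1 three_ne_zero
  have hrep := hF.errorRep_le hΨ M (t := t) hδ hδ1 hδh hpos
  -- `C + 1` replaces `C` because a tube needs positive width.
  set ε := (C + 1) * (h ^ 3 + h ^ (q + 1)) with hε
  have hε0 : 0 < ε := by positivity
  have hint := fun c => hF.errorInt_le hΨ M (t := t) hδ hδ1 hε0 (p := p) c fun i =>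
    (hback h hpos (hsize.trans (min_le_right _ _)) t δ hδ hδh I _ _ (hp c i)).trans
      (mul_le_mul_of_nonneg_right (le_add_of_nonneg_right zero_le_one) (by positivity))
  have main : ∀ c, |M.volumeFractionApprox p Lapprox c - M.volumeFraction Ψ t δ L c|
            ≤ M.errorRec L Lapprox c / M0 (M.cell c) + M.errorRep Ψ t δ c / M0 (M.cell c)
              + M.errorInt Ψ t δ p c / M0 (M.cell c) ∧
          M.errorRec L Lapprox c / M0 (M.cell c) ≤ K / κ * h ^ (r - 2) ∧
          M.errorRep Ψ t δ c / M0 (M.cell c)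
            ≤ N * (4 * Real.pi * (E * (Real.exp B + 3 * E))) / κ * h ^ 2 ∧
          M.errorInt Ψ t δ p c / M0 (M.cell c)
            ≤ N * (4 * Real.pi * ((C + 1) * (Real.exp B + 6 * (C + 1)))) / κ
              * (h ^ 2 + h ^ q) := by
    intro c
    refine ⟨M.abs_volumeFraction_sub_le hF hdiv hU huU hΨ hM (mul_pos hσ hpos) hδ hδU hLΩ c
      (hLfin c) (hrep c).1 (hint c).1, ?_, ?_, ?_⟩
    · refine (hdiv_le c ENNReal.toReal_nonneg (hrec c)).trans (le_of_eq ?_)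
      rw [hh, Real.rpow_sub hpos, Real.rpow_two]
      field_simp
    · refine (hdiv_le c ENNReal.toReal_nonneg (hrep c).2).trans ?_
      rw [div_mul_eq_mul_div, div_le_div_iff₀ hκh hκ]
      have e1 : E * h ^ 3 ≤ E * h := by gcongr
      calc _ ≤ N * (4 * Real.pi * (E * h ^ 3 * (Real.exp B * h + 3 * (E * h)))) * κ := by
            gcongr
            exact hM.corners_le c
        _ = _ := by ring
    · refine (hdiv_le c ENNReal.toReal_nonneg (hint c).2).trans ?_
      rw [div_mul_eq_mul_div, div_le_div_iff₀ hκh hκ]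
      have e1 : ε ≤ 2 * (C + 1) * h := by
        calc ε ≤ (C + 1) * (h + h) := by rw [hε]; gcongr
          _ = _ := by ring
      calc _ ≤ N * (4 * Real.pi * (ε * (Real.exp B * h + 3 * (2 * (C + 1) * h)))) * κ := by
            gcongr
            exact hM.corners_le c
        _ = _ := by rw [hε]; ring
  refine ⟨?_, main⟩
  have hle : ∀ c, |M.volumeFractionApprox p Lapprox c - M.volumeFraction Ψ t δ L c|
      ≤ K / κ * h ^ (r - 2) + N * (4 * Real.pi * (E * (Real.exp B + 3 * E))) / κ * h ^ 2
        + N * (4 * Real.pi * ((C + 1) * (Real.exp B + 6 * (C + 1)))) / κ * (h ^ 2 + h ^ q) :=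
    fun c => by
      obtain ⟨m0, m1, m2, m3⟩ := main c
      linarith
  -- The supremum norm requires a nonnegative bound. As the sign of `K` is not prescribed, this is
  -- read off from the estimate for some cell.
  obtain ⟨c₀⟩ := M.nonempty_of_size_pos hpos
  exact (pi_norm_le_iff_of_nonneg ((abs_nonneg _).trans (hle c₀))).2 hle
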